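/- Let $q$ be a nonzero integer. For $\omega\in\mathbb R$ and complex functions $u(t,s)$ put $$L(\omega)u=-\tfrac{i}{q}\,\partial_t u-\partial_s^2u+\omega(u+\bar u),\qquad g(u)=-\omega\,\frac{\bar u^2}{1+\bar u}.$$ For $\omega=-\alpha^{-2}$, $\alpha>0$, the equation $L(\omega)u+g(u)=0$ says that $w(t,s)=\alpha e^{i\omega t}(1+u(t/q,s))$ solves $\partial_t w=i(\partial_{ss}w-w/|w|^2)$. For $2\pi$-periodic $u=\sum_{(j,k)\in\mathbb Z^2} u_{j,k}e^{i(jt+ks)}$ put $\|u\|_{H^\sigma}^2=\sum |u_{j,k}|^2(j^2+k^2+1)^\sigma$. (1) Let $k_0\ge 1$ be an integer, $\sigma>1$, and $$\omega_*=-\frac1q\Big(1-\frac1{2k_0^2q}\Big),\qquad j_0=qk_0^2-1 .$$ Then there are $b_0>0$, $C$ and a curve $b\mapsto(u_b,\omega_b)$, $b\in[0,b_0]$, continuous into $H^\sigma\times\mathbb R$, with $b\mapsto u_b$ injective and starting at $b=0$ from $(0,\omega_*)$, such that for every $b\in[0,b_0]$: $u_b$ is a $C^2$ function, $2\pi$-periodic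 in $t$ and in $s$, with $|u_b|<1$, it solves $L(\omega_b)u_b+g(u_b)=0$, it has the symmetries $u_b(t,s)=\overline{u_b}(-t,s)=u_b(t,-s)$, and $$\Big\|u_b-b\big[\cos j_0t-i\,(1-k_0^{-2}/q)\sin j_0t\big]\cos k_0s\Big\|_{H^\sigma}\le Cb^2,\qquad |\omega_b-\omega_*|\le Cb^2 .$$ If $q>0$, then moreover $\omega_b<0$ for all $b\in[0,b_0]$ and, with $\alpha=(-\omega_b)^{-1/2}$, for every $n$, every $\kappa>0$ and every central configuration, that is, distinct $a_0=0,a_1,\dots,a_n\in\mathbb C$ with $-a_j=\sum_{i\ne j}\Gamma_i\frac{a_j-a_i}{|a_j-a_i|^2}$ for $j=0,\dots,n$, where $\Gamma_0=-\kappa$ and $\Gamma_1=\dots=\Gamma_n=1$, the functions $$u_j(t,s)=\alpha e^{i\omega_b t}\big(a_j+a_ju_b(t/q,s)\big),\qquad j=0,\dots,n,$$ are a collision-free $C^2$ solution of the $n+1$ vortex filament system $$\partial_tu_j=i\Big(\Gamma_j\partial_{ss}u_j+\sum_{i\neq j}\Gamma_i\frac{u_j-u_i}{|u_j-u_i|^2}\Big),\qquad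 j=0,\dots,n.$$ (2) Consequently, if $q>0$, $n\ge1$ and $\kappa>0$, every such central configuration has infinitely many homographic standing waves of this fixed period: there are infinitely many collision-free $C^2$ solutions of the filament system of the form $u_j(t,s)=\alpha e^{i\omega t}(a_j+a_ju(t/q,s))$ with $\alpha>0$, $\omega=-\alpha^{-2}$, and $u$ a $C^2$ solution of $L(\omega)u+g(u)=0$ with $|u|<1$ that is $2\pi$-periodic in $t$ and $s$, is not constant in $t$, and satisfies $u(t,s)=\bar u(-t,s)=u(t,-s)$. -/

import Mathlib

open scoped ComplexConjugate ENNReal Topology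

noncomputable section

namespace VortexFilaments

/-! ### The perturbation equation -/

/-- `L(ω) u = -(i/q) ∂ₜ u - ∂ₛ² u + ω (u + ū)`. -/
def linOp (q : ℤ) (ω : ℝ) (u : ℝ → ℝ → ℂ) (t s : ℝ) : ℂ :=
  -(Complex.I / (q : ℂ)) * deriv (fun t' => u t' s) t
    - iteratedDeriv 2 (fun s' => u t s') s
    + (ω : ℂ) * (u t s + conj (u t s))

/-- The nonlinearity, with the sign for which `ω (z + z̄) + g(z) = ω (1 + z - 1 / (1 + z̄))`, so
that `L u + g(u) = 0` is the equation `∂ₜ w = i (∂ₛₛ w - w / |w|²)` for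
`w(t, s) = α exp(iωt) (1 + u(t/q, s))`, `ω = -α⁻²`. -/
def nonlin (ω : ℝ) (z : ℂ) : ℂ :=
  -(ω : ℂ) * (conj z) ^ 2 / (1 + conj z)

/-- `2π`-periodicity in both variables. -/
def DoublyPeriodic (u : ℝ → ℝ → ℂ) : Prop :=
  ∀ t s : ℝ, u (t + 2 * Real.pi) s = u t s ∧ u t (s + 2 * Real.pi) = u t s

/-- The symmetries `u(t,s) = ū(-t,s) = u(t,-s)`. -/
def StandingSymmetric (u : ℝ → ℝ → ℂ) : Prop :=
  ∀ t s : ℝ, u t s = conj (u (-t) s) ∧ u t s = u t (-s)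

/-- Classical `2π`-periodic solutions of `L(ω) u + g(u) = 0` with values in the open unit disc,
where the nonlinearity is analytic. -/
structure IsPeriodicSolution (q : ℤ) (ω : ℝ) (u : ℝ → ℝ → ℂ) : Prop where
  contDiff : ContDiff ℝ 2 (Function.uncurry u)
  periodic : DoublyPeriodic u
  norm_lt_one : ∀ t s : ℝ, ‖u t s‖ < 1
  equation : ∀ t s : ℝ, linOp q ω u t s + nonlin ω (u t s) = 0

/-! ### Sobolev norms on the torus -/

/-- The Fourier coefficient `(2π)⁻² ∫∫ u(t,s) exp(-i(jt+ks)) ds dt` over one period. -/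
def torusCoeff (u : ℝ → ℝ → ℂ) (j k : ℤ) : ℂ :=
  (1 / (2 * (Real.pi : ℂ)) ^ 2) *
    ∫ t in (0 : ℝ)..(2 * Real.pi), ∫ s in (0 : ℝ)..(2 * Real.pi),
      u t s * Complex.exp (-Complex.I * ((j : ℂ) * (t : ℂ) + (k : ℂ) * (s : ℂ)))

/-- The `H^σ` norm, `‖u‖² = ∑ |u_{j,k}|² (j² + k² + 1)^σ`, with the value `∞` when the sum
diverges. -/
def sobolevNorm (σ : ℝ) (u : ℝ → ℝ → ℂ) : ℝ≥0∞ :=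
  (∑' p : ℤ × ℤ, ENNReal.ofReal
    (‖torusCoeff u p.1 p.2‖ ^ 2 * ((p.1 : ℝ) ^ 2 + (p.2 : ℝ) ^ 2 + 1) ^ σ)) ^ (1 / 2 : ℝ)

/-! ### Data of the bifurcation -/

/-- `ω₀ = -(1/q) (1 - 1 / (2 k₀² q))`. -/
def omega0 (q : ℤ) (k₀ : ℕ) : ℝ :=
  -(1 / (q : ℝ)) * (1 - 1 / (2 * (k₀ : ℝ) ^ 2 * (q : ℝ)))

/-- `j₀ = q k₀² - 1`. -/
def j0 (q : ℤ) (k₀ : ℕ) : ℤ :=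
  q * (k₀ : ℤ) ^ 2 - 1

/-- The profile `[cos j₀t - i (1 - k₀⁻²/q) sin j₀t] cos k₀s`, which spans the space of symmetric
periodic functions in the kernel of `L(ω₀)`. -/
def profile (q : ℤ) (k₀ : ℕ) (t s : ℝ) : ℂ :=
  ((Real.cos ((j0 q k₀ : ℝ) * t) : ℂ)
      - Complex.I * (((1 - ((k₀ : ℝ) ^ 2)⁻¹ / (q : ℝ)) * Real.sin ((j0 q k₀ : ℝ) * t) : ℝ) : ℂ))
    * (Real.cos ((k₀ : ℝ) * s) : ℂ)

/-! ### The filament system -/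

/-- The circulations `Γ₀ = -κ` and `Γⱼ = 1` for `j = 1, …, n`. -/
def circulation (n : ℕ) (κ : ℝ) : Fin (n + 1) → ℝ :=
  Fin.cons (-κ) (fun _ => 1)

/-- Central configurations of `n + 1` distinct points with `a₀ = 0`. -/
structure IsCentralConfiguration (n : ℕ) (κ : ℝ) (a : Fin (n + 1) → ℂ) : Prop where
  injective : Function.Injective a
  center : a 0 = 0
  equation : ∀ j, -a j = ∑ i ∈ Finset.univ.erase j,
    (circulation n κ i : ℂ) * ((a j - a i) / ((‖a j - a i‖ ^ 2 : ℝ) : ℂ))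

/-- Classical collision-free solutions of the system
`∂ₜ uⱼ = i (Γⱼ ∂ₛₛ uⱼ + ∑_{i ≠ j} Γᵢ (uⱼ - uᵢ) / |uⱼ - uᵢ|²)`, `j = 0, …, n`. -/
structure IsFilamentSolution (n : ℕ) (κ : ℝ) (U : Fin (n + 1) → ℝ → ℝ → ℂ) : Prop where
  contDiff : ∀ j, ContDiff ℝ 2 (Function.uncurry (U j))
  noCollision : ∀ i j, i ≠ j → ∀ t s : ℝ, U i t s ≠ U j t s
  equation : ∀ j, ∀ t s : ℝ, deriv (fun t' => U j t' s) t =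
    Complex.I * ((circulation n κ j : ℂ) * iteratedDeriv 2 (fun s' => U j t s') s
      + ∑ i ∈ Finset.univ.erase j, (circulation n κ i : ℂ) *
          ((U j t s - U i t s) / ((‖U j t s - U i t s‖ ^ 2 : ℝ) : ℂ)))

/-- The homographic motion `uⱼ(t,s) = α exp(iωt) (aⱼ + aⱼ u(t/q, s))`. -/
def homographic {n : ℕ} (a : Fin (n + 1) → ℂ) (q : ℤ) (α ω : ℝ) (u : ℝ → ℝ → ℂ) :
    Fin (n + 1) → ℝ → ℝ → ℂ :=
  fun j t s => (α : ℂ) * Complex.exp (Complex.I * (ω : ℂ) * (t : ℂ)) *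
    (a j + a j * u (t / (q : ℝ)) s)

end VortexFilaments

end

noncomputable section

namespace VortexFilaments

/-! The proof is a Lyapunov–Schmidt reduction at a simple kernel, carried out on weighted absolutely
summable Fourier coefficients. Real coefficients that are even in `k` encode exactly the two
symmetries. The weight is submultiplicative, so these families form a Banach algebra under
convolution; it consists of `C²` functions and controls the `H^σ` norm as soon as the weight has
degree `r ≥ max 2 σ`.

On the pair of frequencies `±(j, k)` the operator `L(ω)` is the symmetric matrix with diagonal `A ±
J` and off-diagonal entry `ω`, where `A = k² + ω` and `J = j/q`. At `ω₀` its determinant is a fixed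
multiple of the integer `resonance`. Because `|q k² - 1|` and `|j|` are integers, that number is at
least a constant times `1 + k² + |j|` off a finite set (`resonance_eq_zero_or_le`). There are thus
no small divisors, and `L(ω₀)` has a bounded inverse modulo a one-dimensional kernel spanned by the
profile (`exists_partialInverse`). No derivatives are gained, and none are needed, since the
nonlinearity is bounded on the algebra.

Write `u = b g` with `g = φ + v`, and `ω = ω₀ + μ`. After division by `b` the equation becomes
`L(ω₀) g + μ (g + ḡ) - (ω₀ + μ) b y = 0`, where `y` is the quotient `ḡ² / (1 + b ḡ)`. Taking `y` as
a further unknown, subject to `y + b ḡ y = ḡ²`, makes the whole system polynomial, so the implicit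
function theorem applies directly (`exists_branch`). The required nondegeneracy is
`kernelFunctional_transversal`. The bound `μ = O(b²)` holds because the square of the conjugate
profile has no component along the kernel.

For the filaments, all the curves are multiples `a_j w` of one function `w`, and the central
configuration equation reduces the system to the single equation for `w`. Infinitely many waves come
from the branch `k₀ = 2`: it is never stationary, and a homographic motion determines its
perturbation (`homographic_injective`). -/

/-! ### Bifurcation from a simple kernel with a bounded partial inverse -/

section Branch

variable {X : Type*} [NormedAddCommGroup X] [NormedSpace ℝ X]

/-- An implicit function theorem at the origin, for maps that restrict to the identity to first
order on the slice `{0} × E`. -/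
theorem exists_implicit_curve {E : Type*} [NormedAddCommGroup E] [NormedSpace ℝ E]
    [CompleteSpace E] (F : ℝ × E → E) (hF : ContDiff ℝ 1 F) (h0 : F (0, 0) = 0)
    (hd : HasFDerivAt (fun x => F (0, x)) (ContinuousLinearMap.id ℝ E) 0) :
    ∃ b₀ : ℝ, 0 < b₀ ∧ ∃ C : ℝ, 0 ≤ C ∧ ∃ x : ℝ → E, x 0 = 0 ∧
      ContinuousOn x (Set.Icc 0 b₀) ∧
      ∀ b ∈ Set.Icc 0 b₀, F (b, x b) = 0 ∧ ‖x b‖ ≤ C * b := by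
  have hc : ContDiffAt ℝ 1 F (0, 0) := hF.contDiffAt
  have h1 : (1 : WithTop ℕ∞) ≠ 0 := one_ne_zero
  have hinv : (fderiv ℝ F (0, 0) ∘L .inr ℝ ℝ E).IsInvertible := by
    have h2 : HasFDerivAt (fun x : E => F (0, x)) (fderiv ℝ F (0, 0) ∘L .inr ℝ ℝ E) 0 := by
      have := (hc.differentiableAt h1).hasFDerivAt
      exact HasFDerivAt.comp (0 : E) (g := F) (f := fun x : E => ((0 : ℝ), x)) this
        (hasFDerivAt_prodMk_right 0 0)
    rw [h2.unique hd]
    exact ⟨ContinuousLinearEquiv.refl ℝ E, rfl⟩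
  set x := hc.implicitFunction h1 hinv with hx
  have hx0 : x 0 = 0 := hc.implicitFunction_apply_self h1 hinv
  have hxc : ContDiffAt ℝ 1 x 0 := hc.contDiffAt_implicitFunction h1 hinv
  -- A map that is `C¹` at a point is `C¹`, hence continuous, at all nearby points.
  have hcont : ∀ᶠ b in 𝓝 (0 : ℝ), ContinuousAt x b :=
    (hxc.eventually (by simp)).mono fun b hb => hb.continuousAt
  have heq : ∀ᶠ b in 𝓝 (0 : ℝ), F (b, x b) = 0 := by
    have := hc.eventually_apply_implicitFunction h1 hinv
    simpa [h0] using this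
  obtain ⟨C, hC0, hC⟩ := ((hxc.differentiableAt h1).isBigO_sub).exists_nonneg
  obtain ⟨ε, hε, hball⟩ := Metric.eventually_nhds_iff.1 (hcont.and (heq.and hC.bound))
  have hmem : ∀ b ∈ Set.Icc 0 (ε / 2), dist b 0 < ε := by
    intro b hb
    rw [Real.dist_eq, sub_zero, abs_of_nonneg hb.1]
    linarith [hb.2]
  refine ⟨ε / 2, by positivity, C, hC0, x, hx0, fun b hb => ?_, fun b hb => ?_⟩
  · exact (hball (hmem b hb)).1.continuousWithinAt
  · have := (hball (hmem b hb)).2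
    refine ⟨this.1, ?_⟩
    simpa [hx0, abs_of_nonneg hb.1] using this.2

/-- The forcing term of the rescaled equation. -/
def forcing (R : X →L[ℝ] X) (φ : X) (ω₀ b : ℝ) (v : X) (μ : ℝ) (y : X) : X :=
  μ • (φ + v + R (φ + v)) - ((ω₀ + μ) * b) • y

/-- The Lyapunov–Schmidt system, in the unknowns `v`, `μ` and the correction `h` of the quadratic
term, preconditioned so that its linear part at the origin is the identity. -/
def branchMap (K R : X →L[ℝ] X) (P : X →L[ℝ] ℝ) (B : X →L[ℝ] X →L[ℝ] X) (φ : X) (ω₀ : ℝ)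
    (p : ℝ × X × ℝ × X) : X × ℝ × X :=
  let b := p.1
  let v := p.2.1
  let μ := p.2.2.1
  let h := p.2.2.2
  let ψ := φ + R φ
  let z := R (φ + v)
  let W := forcing R φ ω₀ b v μ (B z z + h)
  (v + K (W - (P W / P ψ) • ψ), P W / P ψ, h + b • B z (B z z + h))

/-- The map is polynomial in its arguments, because the quotient is an unknown and no inverse in the
algebra is formed. -/
theorem contDiff_branchMap (K R : X →L[ℝ] X) (P : X →L[ℝ] ℝ) (B : X →L[ℝ] X →L[ℝ] X) (φ : X)
    (ω₀ : ℝ) : ContDiff ℝ 1 (branchMap K R P B φ ω₀) := by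
  unfold branchMap forcing
  fun_prop

/-- For `b = 0` the forcing is `μ (ψ + v + R v)` with `ψ = φ + R φ`. The projection along `ψ`
removes `μ ψ` from the first component, and division by `P ψ` turns it into `μ` in the second. What
remains is a product of `μ` with a linear function of `v`, so its derivative at the origin vanishes.
-/
theorem hasFDerivAt_branchMap (K R : X →L[ℝ] X) (P : X →L[ℝ] ℝ) (B : X →L[ℝ] X →L[ℝ] X) (φ : X)
    (ω₀ : ℝ) (hP : P (φ + R φ) ≠ 0) :
    HasFDerivAt (fun x => branchMap K R P B φ ω₀ (0, x))
      (ContinuousLinearMap.id ℝ (X × ℝ × X)) 0 := by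
  have key : (fun x : X × ℝ × X => branchMap K R P B φ ω₀ (0, x)) = fun x =>
      (x.1 + x.2.1 • K (x.1 + R x.1 - (P (x.1 + R x.1) / P (φ + R φ)) • (φ + R φ)),
        x.2.1 + x.2.1 * (P (x.1 + R x.1) / P (φ + R φ)), x.2.2) := by
    funext x
    have e : forcing R φ ω₀ 0 x.1 x.2.1 (B (R (φ + x.1)) (R (φ + x.1)) + x.2.2)
        = x.2.1 • (φ + R φ) + x.2.1 • (x.1 + R x.1) := by
      simp only [forcing, mul_zero, zero_smul, sub_zero, map_add]
      module
    simp only [branchMap, e, zero_smul, add_zero]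
    have e2 : P (x.2.1 • (φ + R φ) + x.2.1 • (x.1 + R x.1)) / P (φ + R φ)
        = x.2.1 + x.2.1 * (P (x.1 + R x.1) / P (φ + R φ)) := by
      rw [map_add, map_smul, map_smul, smul_eq_mul, smul_eq_mul]
      field_simp
    rw [e2, ← map_smul]
    congr 3
    module
  rw [key]
  set L : X →L[ℝ] X := K ∘L ((ContinuousLinearMap.id ℝ X + R)
    - ((P (φ + R φ))⁻¹ • (P ∘L (ContinuousLinearMap.id ℝ X + R))).smulRight (φ + R φ)) with hL
  set l : X →L[ℝ] ℝ := (P (φ + R φ))⁻¹ • (P ∘L (ContinuousLinearMap.id ℝ X + R)) with hl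
  have hf : HasFDerivAt (fun x : X × ℝ × X => x.1) (.fst ℝ X (ℝ × X)) 0 := hasFDerivAt_fst
  have hs : HasFDerivAt (fun x : X × ℝ × X => x.2) (.snd ℝ X (ℝ × X)) 0 := hasFDerivAt_snd
  have hμ : HasFDerivAt (fun x : X × ℝ × X => x.2.1)
      (.fst ℝ ℝ X ∘L .snd ℝ X (ℝ × X)) 0 := hs.fst
  have hh : HasFDerivAt (fun x : X × ℝ × X => x.2.2)
      (.snd ℝ ℝ X ∘L .snd ℝ X (ℝ × X)) 0 := hs.snd
  have hLf : HasFDerivAt (fun x : X × ℝ × X => L x.1) (L ∘L .fst ℝ X (ℝ × X)) 0 :=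
    L.hasFDerivAt.comp _ hf
  have hlf : HasFDerivAt (fun x : X × ℝ × X => l x.1) (l ∘L .fst ℝ X (ℝ × X)) 0 :=
    l.hasFDerivAt.comp _ hf
  have hA := hf.add (hμ.smul hLf)
  have hB := hμ.add (hμ.mul hlf)
  refine ((hA.prodMk (hB.prodMk hh)).congr_fderiv ?_).congr_of_eventuallyEq
    (Filter.Eventually.of_forall fun x => ?_)
  · ext x <;> simp
  · simp [hL, hl, div_eq_inv_mul, mul_add]

/-- A curve of solutions of the Lyapunov–Schmidt system. The quadratic term `B (Rφ) (Rφ)` does not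
see the kernel, which makes the parameter `μ` of second order. -/
theorem exists_branch [CompleteSpace X] (K R : X →L[ℝ] X) (P : X →L[ℝ] ℝ) (B : X →L[ℝ] X →L[ℝ] X) (φ : X)
    (ω₀ : ℝ) (hP : P (φ + R φ) ≠ 0) (hB : P (B (R φ) (R φ)) = 0) :
    ∃ b₀ : ℝ, 0 < b₀ ∧ ∃ C : ℝ, 0 ≤ C ∧ ∃ (v : ℝ → X) (μ : ℝ → ℝ) (y : ℝ → X),
      v 0 = 0 ∧ μ 0 = 0 ∧ ContinuousOn v (Set.Icc 0 b₀) ∧ ContinuousOn μ (Set.Icc 0 b₀) ∧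
      ∀ b ∈ Set.Icc 0 b₀,
        y b + b • B (R (φ + v b)) (y b) = B (R (φ + v b)) (R (φ + v b)) ∧
        v b = - K (forcing R φ ω₀ b (v b) (μ b) (y b)) ∧
        P (forcing R φ ω₀ b (v b) (μ b) (y b)) = 0 ∧
        ‖v b‖ ≤ C * b ∧ |μ b| ≤ C * b ^ 2 := by
  obtain ⟨b₀, hb₀, C, hC, x, hx0, hxc, hx⟩ := exists_implicit_curve (branchMap K R P B φ ω₀)
    (contDiff_branchMap K R P B φ ω₀) (by simp [branchMap, forcing])
    (hasFDerivAt_branchMap K R P B φ ω₀ hP)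
  set ψ := φ + R φ with hψ
  set Z : ℝ → X := fun b => R (φ + (x b).1) with hZ
  set Y : ℝ → X := fun b => B (Z b) (Z b) + (x b).2.2 with hY
  have hb_le : ∀ b ∈ Set.Icc 0 b₀, ‖(x b).1‖ ≤ C * b ∧ |(x b).2.1| ≤ C * b ∧
      ‖(x b).2.2‖ ≤ C * b := by
    intro b hb
    have h := (hx b hb).2
    refine ⟨(norm_fst_le (x b)).trans h, ?_, ?_⟩
    · rw [← Real.norm_eq_abs]
      exact (norm_fst_le (x b).2).trans ((norm_snd_le (x b)).trans h)
    · exact (norm_snd_le (x b).2).trans ((norm_snd_le (x b)).trans h)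
  have heq : ∀ b ∈ Set.Icc 0 b₀,
      P (forcing R φ ω₀ b (x b).1 (x b).2.1 (Y b)) = 0 ∧
      (x b).1 = - K (forcing R φ ω₀ b (x b).1 (x b).2.1 (Y b)) ∧
      (x b).2.2 + b • B (Z b) (Y b) = 0 := by
    intro b hb
    have h := (hx b hb).1
    simp only [branchMap, Prod.mk_eq_zero] at h
    have h2 := h.2.1
    have hPW : P (forcing R φ ω₀ b (x b).1 (x b).2.1 (Y b)) = 0 := by
      exact (div_eq_zero_iff.1 h2).resolve_right hP
    refine ⟨hPW, ?_, h.2.2⟩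
    have h3 := h.1
    rw [h2, zero_smul, sub_zero] at h3
    exact eq_neg_of_add_eq_zero_left h3
  -- the quadratic term is seen by `P` only to first order
  set M : ℝ := ‖P‖ * (‖B‖ * ‖R‖ ^ 2 * (2 * ‖φ‖ + C * b₀) * C + C) with hM
  have hPY : ∀ b ∈ Set.Icc 0 b₀, |P (Y b)| ≤ M * b := by
    intro b hb
    obtain ⟨h1, -, h3⟩ := hb_le b hb
    have hBle : ∀ a c : X, ‖B (R a) (R c)‖ ≤ ‖B‖ * ‖R‖ ^ 2 * (‖a‖ * ‖c‖) := fun a c => by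
      calc ‖B (R a) (R c)‖ ≤ ‖B‖ * ‖R a‖ * ‖R c‖ := B.le_opNorm₂ _ _
        _ ≤ ‖B‖ * (‖R‖ * ‖a‖) * (‖R‖ * ‖c‖) := by gcongr <;> exact R.le_opNorm _
        _ = _ := by ring
    -- Expanding `B (R(φ + v)) (R(φ + v))`, the hypothesis `hB` removes the only term that is not
    -- small with `b`.
    have e : P (Y b) = P (B (R (x b).1) (R (x b).1) + B (R φ) (R (x b).1)
        + B (R (x b).1) (R φ) + (x b).2.2) := by
      have : Y b = B (R φ) (R φ) + (B (R (x b).1) (R (x b).1) + B (R φ) (R (x b).1)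
        + B (R (x b).1) (R φ) + (x b).2.2) := by
        simp only [hY, hZ, map_add, add_apply]
        abel
      rw [this, map_add, hB, zero_add]
    have hv2 : ‖(x b).1‖ ≤ C * b₀ := h1.trans (by gcongr; exact hb.2)
    rw [e, ← Real.norm_eq_abs]
    calc _ ≤ ‖P‖ * ‖B (R (x b).1) (R (x b).1) + B (R φ) (R (x b).1)
        + B (R (x b).1) (R φ) + (x b).2.2‖ := P.le_opNorm _
      _ ≤ ‖P‖ * (‖B‖ * ‖R‖ ^ 2 * (‖(x b).1‖ * ‖(x b).1‖) + ‖B‖ * ‖R‖ ^ 2 * (‖φ‖ * ‖(x b).1‖)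
          + ‖B‖ * ‖R‖ ^ 2 * (‖(x b).1‖ * ‖φ‖) + ‖(x b).2.2‖) := by
        gcongr
        refine (norm_add_le _ _).trans (add_le_add_left ((norm_add_le _ _).trans (add_le_add
          ((norm_add_le _ _).trans (add_le_add ?_ ?_)) ?_)) _) <;> exact hBle _ _
      _ = ‖P‖ * (‖B‖ * ‖R‖ ^ 2 * (2 * ‖φ‖ + ‖(x b).1‖) * ‖(x b).1‖ + ‖(x b).2.2‖) := by ring
      _ ≤ ‖P‖ * (‖B‖ * ‖R‖ ^ 2 * (2 * ‖φ‖ + C * b₀) * (C * b) + C * b) := by gcongr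
      _ = M * b := by ring
  have hMnn : 0 ≤ M := by positivity
  -- From `P W = 0`: `μ P ψ = (ω₀ + μ) b P y - μ P (v + R v)`. Both terms on the right are `O(b²)`,
  -- since `P y`, `μ` and `v` are `O(b)`.
  set D : ℝ := (C * (‖P‖ * (1 + ‖R‖) * C) + (|ω₀| + C * b₀) * M) / |P ψ| with hD
  have hDnn : 0 ≤ D := by positivity
  have hPψ : 0 < |P ψ| := abs_pos.2 hP
  have hμ : ∀ b ∈ Set.Icc 0 b₀, |(x b).2.1| ≤ D * b ^ 2 := by
    intro b hb
    obtain ⟨h1, h2, -⟩ := hb_le b hb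
    have hb0 : 0 ≤ b := hb.1
    have h := (heq b hb).1
    simp only [forcing, map_sub, map_smul, smul_eq_mul] at h
    have e : (x b).2.1 * P ψ = (ω₀ + (x b).2.1) * b * P (Y b)
        - (x b).2.1 * P ((x b).1 + R (x b).1) := by
      simp only [hψ, map_add] at h ⊢
      linarith
    have hPv : |P ((x b).1 + R (x b).1)| ≤ ‖P‖ * (1 + ‖R‖) * C * b := by
      rw [← Real.norm_eq_abs]
      calc _ ≤ ‖P‖ * ‖(x b).1 + R (x b).1‖ := P.le_opNorm _
        _ ≤ ‖P‖ * (‖(x b).1‖ + ‖R‖ * ‖(x b).1‖) := by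
          gcongr
          exact (norm_add_le _ _).trans (add_le_add_right (R.le_opNorm _) _)
        _ = ‖P‖ * (1 + ‖R‖) * ‖(x b).1‖ := by ring
        _ ≤ ‖P‖ * (1 + ‖R‖) * (C * b) := by gcongr
        _ = _ := by ring
    have hω : |ω₀ + (x b).2.1| ≤ |ω₀| + C * b₀ :=
      (abs_add_le _ _).trans (add_le_add_right (h2.trans (by gcongr; exact hb.2)) _)
    have : |(x b).2.1| * |P ψ| ≤ D * |P ψ| * b ^ 2 := by
      rw [← abs_mul, e, hD, div_mul_cancel₀ _ hPψ.ne']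
      calc _ ≤ |(ω₀ + (x b).2.1) * b * P (Y b)| + |(x b).2.1 * P ((x b).1 + R (x b).1)| :=
            abs_sub _ _
        _ ≤ (|ω₀| + C * b₀) * b * (M * b) + C * b * (‖P‖ * (1 + ‖R‖) * C * b) := by
          rw [abs_mul, abs_mul, abs_mul, abs_of_nonneg hb0]
          gcongr
          exact hPY b hb
        _ = _ := by ring
    refine le_of_mul_le_mul_right (this.trans_eq ?_) hPψ
    ring
  refine ⟨b₀, hb₀, max C D, hC.trans (le_max_left _ _), fun b => (x b).1, fun b => (x b).2.1, Y,
    by simp [hx0], by simp [hx0], hxc.fst, hxc.snd.fst, fun b hb => ⟨?_, (heq b hb).2.1,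
      (heq b hb).1, (hb_le b hb).1.trans ?_, (hμ b hb).trans ?_⟩⟩
  · have h := (heq b hb).2.2
    change B (Z b) (Z b) + (x b).2.2 + b • B (Z b) (Y b) = B (Z b) (Z b)
    rw [add_assoc, h, add_zero]
  · exact mul_le_mul_of_nonneg_right (le_max_left _ _) hb.1
  · exact mul_le_mul_of_nonneg_right (le_max_right _ _) (sq_nonneg b)

end Branch

/-! ### Summable families of real Fourier coefficients -/

/-- Absolutely summable real families indexed by the frequencies `(j, k)`. -/
abbrev Coeffs : Type := lp (fun _ : ℤ × ℤ => ℝ) 1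

theorem Coeffs.summable_norm (f : Coeffs) : Summable fun p => ‖f p‖ := by
  have := (lp.memℓp f).summable (by simp)
  simpa using this

theorem Coeffs.norm_eq_tsum (f : Coeffs) : ‖f‖ = ∑' p, ‖f p‖ := by
  simpa using lp.norm_eq_tsum_rpow (by simp) f

theorem Coeffs.norm_apply_le (f : Coeffs) (p : ℤ × ℤ) : ‖f p‖ ≤ ‖f‖ :=
  lp.norm_apply_le_norm one_ne_zero f p

/-- The family supported at one frequency. -/
abbrev Coeffs.single (p : ℤ × ℤ) : Coeffs := lp.single 1 p (1 : ℝ)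

theorem Coeffs.norm_single (p : ℤ × ℤ) : ‖Coeffs.single p‖ = 1 := by
  simp [Coeffs.single, lp.norm_single]

theorem Coeffs.single_apply (p n : ℤ × ℤ) : Coeffs.single p n = if n = p then 1 else 0 := by
  rw [lp.single_apply, Pi.single_apply]

section SumMap

variable {Y : Type*} [NormedAddCommGroup Y] [NormedSpace ℝ Y]

theorem Coeffs.summable_norm_smul (f : Coeffs) {x : ℤ × ℤ → Y} {C : ℝ} (hx : ∀ p, ‖x p‖ ≤ C) :
    Summable fun p => ‖f p • x p‖ := by
  refine Summable.of_nonneg_of_le (fun _ => norm_nonneg _) (fun p => ?_)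
    (f.summable_norm.mul_right C)
  rw [norm_smul]
  exact mul_le_mul_of_nonneg_left (hx p) (norm_nonneg _)

theorem Coeffs.norm_tsum_smul_le [CompleteSpace Y] (f : Coeffs) {x : ℤ × ℤ → Y} {C : ℝ}
    (hx : ∀ p, ‖x p‖ ≤ C) : ‖∑' p, f p • x p‖ ≤ C * ‖f‖ := by
  have h1 : Summable fun p => ‖f p • x p‖ := f.summable_norm_smul hx
  have h2 : Summable fun p => C * ‖f p‖ := f.summable_norm.mul_left C
  have h3 : ∀ p, ‖f p • x p‖ ≤ C * ‖f p‖ := fun p => by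
    rw [norm_smul, mul_comm C]
    exact mul_le_mul_of_nonneg_left (hx p) (norm_nonneg _)
  calc ‖∑' p, f p • x p‖ ≤ ∑' p, ‖f p • x p‖ := norm_tsum_le_tsum_norm h1
    _ ≤ ∑' p, C * ‖f p‖ := h1.tsum_le_tsum h3 h2
    _ = C * ‖f‖ := by rw [tsum_mul_left, f.norm_eq_tsum]

/-- The bounded operator `f ↦ ∑ f p • x p` attached to a bounded family `x`. -/
def sumMap [CompleteSpace Y] (x : ℤ × ℤ → Y) (C : ℝ) (hx : ∀ p, ‖x p‖ ≤ C) :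
    Coeffs →L[ℝ] Y :=
  LinearMap.mkContinuous
    { toFun := fun f => ∑' p, f p • x p
      map_add' := fun f g => by
        have hf : Summable fun p => f p • x p := (f.summable_norm_smul hx).of_norm
        have hg : Summable fun p => g p • x p := (g.summable_norm_smul hx).of_norm
        rw [← hf.tsum_add hg]
        exact tsum_congr fun p => add_smul (f p) (g p) (x p)
      map_smul' := fun c f => by
        have hf : Summable fun p => f p • x p := (f.summable_norm_smul hx).of_norm
        rw [RingHom.id_apply, ← hf.tsum_const_smul]
        exact tsum_congr fun p => mul_smul c (f p) (x p) } C
    (fun f => f.norm_tsum_smul_le hx)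

theorem hasSum_sumMap [CompleteSpace Y] {x : ℤ × ℤ → Y} {C : ℝ} (hx : ∀ p, ‖x p‖ ≤ C) (f : Coeffs) :
    HasSum (fun p => f p • x p) (sumMap x C hx f) :=
  ((f.summable_norm_smul hx).of_norm).hasSum

theorem sumMap_single [CompleteSpace Y] {x : ℤ × ℤ → Y} {C : ℝ} (hx : ∀ p, ‖x p‖ ≤ C) (p : ℤ × ℤ) :
    sumMap x C hx (Coeffs.single p) = x p := by
  refine (hasSum_sumMap hx _).unique ?_
  convert! hasSum_ite_eq p (x p) using 2 with n
  rw [Coeffs.single_apply]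
  split_ifs with h <;> simp [h]

theorem norm_sumMap_le [CompleteSpace Y] {x : ℤ × ℤ → Y} {C : ℝ} (hx : ∀ p, ‖x p‖ ≤ C) : ‖sumMap x C hx‖ ≤ C :=
  LinearMap.mkContinuous_norm_le _ ((norm_nonneg _).trans (hx 0)) _

end SumMap

/-- Finite families are dense in `ℓ¹`. Operator identities below are therefore checked on single
frequencies only. -/
theorem Coeffs.clm_ext {Y : Type*} [NormedAddCommGroup Y] [NormedSpace ℝ Y]
    {T T' : Coeffs →L[ℝ] Y} (h : ∀ p, T (Coeffs.single p) = T' (Coeffs.single p)) : T = T' := by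
  refine lp.ext_continuousLinearMap (by simp) fun p => ?_
  ext
  simpa using h p

/-! ### Multipliers, conjugation and reflection on coefficients -/

/-- The operator `(T f) p = m p * f (e p)` for a bounded multiplier `m`. -/
def reindexMul (e : ℤ × ℤ ≃ ℤ × ℤ) (m : ℤ × ℤ → ℝ) (C : ℝ) (hm : ∀ p, |m p| ≤ C) :
    Coeffs →L[ℝ] Coeffs :=
  sumMap (fun p => m (e.symm p) • Coeffs.single (e.symm p)) C
    (fun p => by rw [norm_smul, Coeffs.norm_single, mul_one]; exact hm _)

/-- Evaluation of a coefficient. -/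
def coord (p : ℤ × ℤ) : Coeffs →L[ℝ] ℝ :=
  sumMap (fun n => if n = p then 1 else 0) 1 (fun n => by split_ifs <;> simp)

theorem coord_apply (p : ℤ × ℤ) (f : Coeffs) : coord p f = f p := by
  refine (hasSum_sumMap _ f).unique ?_
  convert! hasSum_ite_eq p (f p) using 2 with n
  split_ifs with h <;> simp [h]

theorem reindexMul_apply (e : ℤ × ℤ ≃ ℤ × ℤ) (m : ℤ × ℤ → ℝ) (C : ℝ) (hm : ∀ p, |m p| ≤ C)
    (f : Coeffs) (p : ℤ × ℤ) : reindexMul e m C hm f p = m p * f (e p) := by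
  have : (coord p ∘L reindexMul e m C hm) = m p • coord (e p) := by
    refine Coeffs.clm_ext fun n => ?_
    rw [ContinuousLinearMap.comp_apply, reindexMul, sumMap_single, map_smul, coord_apply,
      Coeffs.single_apply, smul_apply, coord_apply, Coeffs.single_apply]
    by_cases h : p = e.symm n
    · simp [h]
    · have h' : ¬ e p = n := fun h2 => h (by simp [← h2])
      simp [h, h']
  have h := congrArg (fun T : Coeffs →L[ℝ] ℝ => T f) this
  simpa [coord_apply] using h

theorem reindexMul_single (e : ℤ × ℤ ≃ ℤ × ℤ) (m : ℤ × ℤ → ℝ) (C : ℝ) (hm : ∀ p, |m p| ≤ C)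
    (p : ℤ × ℤ) : reindexMul e m C hm (Coeffs.single p)
      = m (e.symm p) • Coeffs.single (e.symm p) :=
  sumMap_single _ p

/-- The coefficients of the complex conjugate function. -/
def conjCoeffs : Coeffs →L[ℝ] Coeffs := reindexMul (Equiv.neg (ℤ × ℤ)) 1 1 (by simp)

theorem conjCoeffs_apply (f : Coeffs) (p : ℤ × ℤ) : conjCoeffs f p = f (-p) := by
  simp [conjCoeffs, reindexMul_apply]

theorem conjCoeffs_single (p : ℤ × ℤ) : conjCoeffs (Coeffs.single p) = Coeffs.single (-p) := by
  rw [conjCoeffs, reindexMul_single]; simp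

/-- The coefficients of the function reflected in `s`. -/
def flipCoeffs : Coeffs →L[ℝ] Coeffs :=
  reindexMul (Equiv.prodCongr (Equiv.refl ℤ) (Equiv.neg ℤ)) 1 1 (by simp)

theorem flipCoeffs_apply (f : Coeffs) (p : ℤ × ℤ) : flipCoeffs f p = f (p.1, -p.2) := by
  rw [flipCoeffs, reindexMul_apply]; simp; rfl

theorem flipCoeffs_single (p : ℤ × ℤ) :
    flipCoeffs (Coeffs.single p) = Coeffs.single (p.1, -p.2) := by
  rw [flipCoeffs, reindexMul_single]; simp; rfl

/-! ### The weighted convolution -/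

/-- The weight `(1 + |j| + |k|) ^ r`. -/
def weight (r : ℕ) (p : ℤ × ℤ) : ℝ := (1 + |(p.1 : ℝ)| + |(p.2 : ℝ)|) ^ r

theorem one_le_weight (r : ℕ) (p : ℤ × ℤ) : 1 ≤ weight r p :=
  one_le_pow₀ (by linarith [abs_nonneg (p.1 : ℝ), abs_nonneg (p.2 : ℝ)])

theorem weight_pos (r : ℕ) (p : ℤ × ℤ) : 0 < weight r p :=
  zero_lt_one.trans_le (one_le_weight r p)

theorem weight_neg (r : ℕ) (p : ℤ × ℤ) : weight r (-p) = weight r p := by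
  simp [weight]

theorem weight_flip (r : ℕ) (p : ℤ × ℤ) : weight r (p.1, -p.2) = weight r p := by
  simp [weight]

/-- Follows from `1 + x + y ≤ (1 + x)(1 + y)` for `x, y ≥ 0`; this is what bounds the weighted
convolution by the product of the norms. -/
theorem weight_add_le (r : ℕ) (p n : ℤ × ℤ) : weight r (p + n) ≤ weight r p * weight r n := by
  unfold weight
  rw [← mul_pow]
  refine pow_le_pow_left₀ (by positivity) ?_ r
  push_cast [Prod.fst_add, Prod.snd_add]
  have h1 := abs_add_le (p.1 : ℝ) n.1
  have h2 := abs_add_le (p.2 : ℝ) n.2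
  nlinarith [mul_nonneg (add_nonneg (abs_nonneg (p.1 : ℝ)) (abs_nonneg (p.2 : ℝ)))
    (add_nonneg (abs_nonneg (n.1 : ℝ)) (abs_nonneg (n.2 : ℝ)))]

theorem norm_weight_ratio_smul_le (r : ℕ) (p n : ℤ × ℤ) :
    ‖(weight r (p + n) / (weight r p * weight r n)) • Coeffs.single (p + n)‖ ≤ 1 := by
  have h1 := weight_pos r p
  have h2 := weight_pos r n
  have h3 := weight_pos r (p + n)
  rw [norm_smul, Coeffs.norm_single, mul_one, Real.norm_of_nonneg (by positivity)]
  exact div_le_one_of_le₀ (weight_add_le r p n) (by positivity)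

/-- The convolution of families of weighted coefficients. -/
def convolution (r : ℕ) : Coeffs →L[ℝ] Coeffs →L[ℝ] Coeffs :=
  sumMap (fun p => sumMap
      (fun n => (weight r (p + n) / (weight r p * weight r n)) • Coeffs.single (p + n)) 1
      (norm_weight_ratio_smul_le r p)) 1
    (fun p => norm_sumMap_le (norm_weight_ratio_smul_le r p))

theorem convolution_single (r : ℕ) (p n : ℤ × ℤ) :
    convolution r (Coeffs.single p) (Coeffs.single n)
      = (weight r (p + n) / (weight r p * weight r n)) • Coeffs.single (p + n) := by
  rw [convolution, sumMap_single, sumMap_single]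

theorem Coeffs.clm_ext₂ {Y : Type*} [NormedAddCommGroup Y] [NormedSpace ℝ Y]
    {T T' : Coeffs →L[ℝ] Coeffs →L[ℝ] Y}
    (h : ∀ p n, T (Coeffs.single p) (Coeffs.single n) = T' (Coeffs.single p) (Coeffs.single n)) :
    T = T' :=
  Coeffs.clm_ext fun p => Coeffs.clm_ext fun n => h p n

theorem flipCoeffs_convolution (r : ℕ) (f g : Coeffs) :
    flipCoeffs (convolution r f g) = convolution r (flipCoeffs f) (flipCoeffs g) := by
  have : (ContinuousLinearMap.compL ℝ Coeffs Coeffs Coeffs flipCoeffs) ∘L convolution r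
      = (convolution r).bilinearComp flipCoeffs flipCoeffs := by
    refine Coeffs.clm_ext₂ fun p n => ?_
    have e : (p.1, -p.2) + (n.1, -n.2) = ((p + n).1, -(p + n).2) := by
      ext <;> simp [add_comm]
    simp only [ContinuousLinearMap.comp_apply, ContinuousLinearMap.compL_apply,
      ContinuousLinearMap.bilinearComp_apply, convolution_single, flipCoeffs_single, map_smul]
    rw [e, weight_flip, weight_flip, weight_flip]
  have h := congrArg (fun T : Coeffs →L[ℝ] Coeffs →L[ℝ] Coeffs => T f g) this
  simpa using h

/-! ### Synthesis of functions from their coefficients -/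

/-- The Fourier mode `exp(i(jt + ks))`. -/
def mode (p : ℤ × ℤ) (t s : ℝ) : ℂ :=
  Complex.exp (Complex.I * ((p.1 : ℂ) * (t : ℂ) + (p.2 : ℂ) * (s : ℂ)))

theorem norm_mode (p : ℤ × ℤ) (t s : ℝ) : ‖mode p t s‖ = 1 := by
  have : mode p t s = Complex.exp (((p.1 * t + p.2 * s : ℝ) : ℂ) * Complex.I) := by
    rw [mode]; push_cast; ring_nf
  rw [this, Complex.norm_exp_ofReal_mul_I]

theorem mode_add (p n : ℤ × ℤ) (t s : ℝ) : mode (p + n) t s = mode p t s * mode n t s := by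
  rw [mode, mode, mode, ← Complex.exp_add]
  push_cast [Prod.fst_add, Prod.snd_add]
  ring_nf

theorem mode_neg (p : ℤ × ℤ) (t s : ℝ) : mode (-p) t s = conj (mode p t s) := by
  rw [mode, mode, ← Complex.exp_conj]
  simp
  ring_nf

theorem mode_flip (p : ℤ × ℤ) (t s : ℝ) : mode (p.1, -p.2) t s = mode p t (-s) := by
  simp [mode]

theorem norm_inv_weight_smul_mode_le (r : ℕ) (t s : ℝ) (p : ℤ × ℤ) :
    ‖(weight r p)⁻¹ • mode p t s‖ ≤ 1 := by
  rw [norm_smul, norm_mode, mul_one, norm_inv, Real.norm_of_nonneg (weight_pos r p).le]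
  exact inv_le_one_of_one_le₀ (one_le_weight r p)

/-- The value at `(t, s)` of the function with coefficients `f p / weight r p`. -/
def synth (r : ℕ) (t s : ℝ) : Coeffs →L[ℝ] ℂ :=
  sumMap (fun p => (weight r p)⁻¹ • mode p t s) 1 (norm_inv_weight_smul_mode_le r t s)

theorem synth_single (r : ℕ) (t s : ℝ) (p : ℤ × ℤ) :
    synth r t s (Coeffs.single p) = (weight r p)⁻¹ • mode p t s :=
  sumMap_single _ p

theorem norm_synth_le (r : ℕ) (t s : ℝ) (f : Coeffs) : ‖synth r t s f‖ ≤ ‖f‖ := by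
  have := (synth r t s).le_of_opNorm_le (norm_sumMap_le _) f
  simpa using this

theorem synth_convolution (r : ℕ) (t s : ℝ) (f g : Coeffs) :
    synth r t s (convolution r f g) = synth r t s f * synth r t s g := by
  have : (ContinuousLinearMap.compL ℝ Coeffs Coeffs ℂ (synth r t s)) ∘L convolution r
      = (ContinuousLinearMap.mul ℝ ℂ).bilinearComp (synth r t s) (synth r t s) := by
    refine Coeffs.clm_ext₂ fun p n => ?_
    simp only [ContinuousLinearMap.comp_apply, ContinuousLinearMap.compL_apply,
      ContinuousLinearMap.bilinearComp_apply, convolution_single, map_smul, synth_single,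
      smul_apply, ContinuousLinearMap.mul_apply', mode_add, smul_smul]
    congr 1
    have h1 := weight_pos r p
    have h2 := weight_pos r n
    have h3 := weight_pos r (p + n)
    field_simp
  have h := congrArg (fun T : Coeffs →L[ℝ] Coeffs →L[ℝ] ℂ => T f g) this
  simpa using h

theorem synth_conjCoeffs (r : ℕ) (t s : ℝ) (f : Coeffs) :
    synth r t s (conjCoeffs f) = conj (synth r t s f) := by
  have : synth r t s ∘L conjCoeffs
      = (Complex.conjCLE : ℂ →L[ℝ] ℂ) ∘L synth r t s := by
    refine Coeffs.clm_ext fun p => ?_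
    simp [conjCoeffs_single, synth_single, mode_neg, weight_neg]
  have h := congrArg (fun T : Coeffs →L[ℝ] ℂ => T f) this
  simpa using h

theorem synth_flipCoeffs (r : ℕ) (t s : ℝ) (f : Coeffs) :
    synth r t s (flipCoeffs f) = synth r t (-s) f := by
  have : synth r t s ∘L flipCoeffs = synth r t (-s) := by
    refine Coeffs.clm_ext fun p => ?_
    simp only [ContinuousLinearMap.comp_apply, flipCoeffs_single, synth_single, weight_flip,
      mode_flip]
  exact congrArg (fun T : Coeffs →L[ℝ] ℂ => T f) this

/-- The coefficients are real, so conjugation only reverses the frequencies, which amounts to `(t,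
s) ↦ (-t, -s)`. -/
theorem conj_synth_neg (r : ℕ) (t s : ℝ) (f : Coeffs) :
    conj (synth r (-t) s f) = synth r t (-s) f := by
  have : (Complex.conjCLE : ℂ →L[ℝ] ℂ) ∘L synth r (-t) s = synth r t (-s) := by
    refine Coeffs.clm_ext fun p => ?_
    have e : conj (mode p (-t) s) = mode p t (-s) := by
      rw [← mode_neg]; simp [mode]
    simp [synth_single, e]
  exact congrArg (fun T : Coeffs →L[ℝ] ℂ => T f) this

theorem mode_add_period_left (p : ℤ × ℤ) (t s : ℝ) :
    mode p (t + 2 * Real.pi) s = mode p t s := by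
  rw [mode, mode, Complex.exp_eq_exp_iff_exists_int]
  exact ⟨p.1, by push_cast; ring⟩

theorem mode_add_period_right (p : ℤ × ℤ) (t s : ℝ) :
    mode p t (s + 2 * Real.pi) = mode p t s := by
  rw [mode, mode, Complex.exp_eq_exp_iff_exists_int]
  exact ⟨p.2, by push_cast; ring⟩

theorem doublyPeriodic_synth (r : ℕ) (f : Coeffs) :
    DoublyPeriodic fun t s => synth r t s f := by
  intro t s
  constructor
  · have : synth r (t + 2 * Real.pi) s = synth r t s :=
      Coeffs.clm_ext fun p => by rw [synth_single, synth_single, mode_add_period_left]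
    exact congrArg (fun T : Coeffs →L[ℝ] ℂ => T f) this
  · have : synth r t (s + 2 * Real.pi) = synth r t s :=
      Coeffs.clm_ext fun p => by rw [synth_single, synth_single, mode_add_period_right]
    exact congrArg (fun T : Coeffs →L[ℝ] ℂ => T f) this

theorem standingSymmetric_synth (r : ℕ) {f : Coeffs} (hf : flipCoeffs f = f) :
    StandingSymmetric fun t s => synth r t s f := by
  intro t s
  have h : synth r t s f = synth r t (-s) f := by
    conv_lhs => rw [← hf]
    exact synth_flipCoeffs r t s f
  exact ⟨h.trans (conj_synth_neg r t s f).symm, h⟩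

/-! ### Regularity of synthesized functions -/

theorem hasSum_synth (r : ℕ) (t s : ℝ) (f : Coeffs) :
    HasSum (fun p => f p • ((weight r p)⁻¹ • mode p t s)) (synth r t s f) :=
  hasSum_sumMap _ f

theorem iteratedDeriv_cexp_I_mul (n : ℕ) :
    iteratedDeriv n (fun y : ℝ => Complex.exp (Complex.I * y))
      = fun y : ℝ => Complex.I ^ n * Complex.exp (Complex.I * y) := by
  induction n with
  | zero => simp
  | succ n ih =>
    rw [iteratedDeriv_succ, ih]
    funext y
    have h : HasDerivAt (fun y : ℝ => Complex.exp (Complex.I * y))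
        (Complex.exp (Complex.I * y) * (Complex.I * 1)) y :=
      ((Complex.ofRealCLM.hasDerivAt (x := y)).const_mul Complex.I).cexp
    rw [(h.const_mul _).deriv]
    ring

theorem contDiff_cexp_I_mul {n : WithTop ℕ∞} :
    ContDiff ℝ n (fun y : ℝ => Complex.exp (Complex.I * y)) :=
  (contDiff_const.mul Complex.ofRealCLM.contDiff).cexp

/-- The phase `jt + ks`. -/
def phase (p : ℤ × ℤ) : ℝ × ℝ →L[ℝ] ℝ :=
  (p.1 : ℝ) • ContinuousLinearMap.fst ℝ ℝ ℝ + (p.2 : ℝ) • ContinuousLinearMap.snd ℝ ℝ ℝ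

theorem norm_phase_le (p : ℤ × ℤ) : ‖phase p‖ ≤ |(p.1 : ℝ)| + |(p.2 : ℝ)| := by
  refine ContinuousLinearMap.opNorm_le_bound _ (by positivity) fun x => ?_
  have h1 : |x.1| ≤ ‖x‖ := norm_fst_le x
  have h2 : |x.2| ≤ ‖x‖ := norm_snd_le x
  calc ‖phase p x‖ = |p.1 * x.1 + p.2 * x.2| := by simp [phase]
    _ ≤ |(p.1 : ℝ)| * |x.1| + |(p.2 : ℝ)| * |x.2| := by
      rw [← abs_mul, ← abs_mul]; exact abs_add_le _ _
    _ ≤ |(p.1 : ℝ)| * ‖x‖ + |(p.2 : ℝ)| * ‖x‖ := by gcongr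
    _ = _ := by ring

theorem mode_eq_comp_phase (p : ℤ × ℤ) :
    (fun x : ℝ × ℝ => mode p x.1 x.2)
      = (fun y : ℝ => Complex.exp (Complex.I * y)) ∘ phase p := by
  funext x
  simp [mode, phase]

theorem contDiff_mode (p : ℤ × ℤ) {n : WithTop ℕ∞} :
    ContDiff ℝ n fun x : ℝ × ℝ => mode p x.1 x.2 := by
  rw [mode_eq_comp_phase]
  exact contDiff_cexp_I_mul.comp (phase p).contDiff

theorem norm_iteratedFDeriv_mode_le (p : ℤ × ℤ) (n : ℕ) (x : ℝ × ℝ) :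
    ‖iteratedFDeriv ℝ n (fun x : ℝ × ℝ => mode p x.1 x.2) x‖
      ≤ (|(p.1 : ℝ)| + |(p.2 : ℝ)|) ^ n := by
  rw [mode_eq_comp_phase, (phase p).iteratedFDeriv_comp_right
    (contDiff_cexp_I_mul (n := n)) x le_rfl]
  refine (ContinuousMultilinearMap.norm_compContinuousLinearMap_le _ _).trans ?_
  rw [norm_iteratedFDeriv_eq_norm_iteratedDeriv, iteratedDeriv_cexp_I_mul, norm_mul, norm_pow,
    Complex.norm_I, one_pow, one_mul, mul_comm Complex.I, Complex.norm_exp_ofReal_mul_I, one_mul]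
  simpa using pow_le_pow_left₀ (norm_nonneg _) (norm_phase_le p) n

theorem pow_le_weight {r n : ℕ} (hn : n ≤ r) (p : ℤ × ℤ) :
    (1 + |(p.1 : ℝ)| + |(p.2 : ℝ)|) ^ n ≤ weight r p :=
  pow_le_pow_right₀ (by linarith [abs_nonneg (p.1 : ℝ), abs_nonneg (p.2 : ℝ)]) hn

/-- Each mode is an exponential of a linear phase, so its `m`-th derivative is at most `(|j| + |k|)
^ m`. The inverse weight absorbs this for `m ≤ r`, leaving the summable majorant `‖f p‖`. -/
theorem contDiff_synth {r : ℕ} (n : ℕ) (hr : n ≤ r) (f : Coeffs) :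
    ContDiff ℝ n (Function.uncurry fun t s => synth r t s f) := by
  have e : (Function.uncurry fun t s => synth r t s f)
      = fun x : ℝ × ℝ => ∑' p, (f p * (weight r p)⁻¹) • mode p x.1 x.2 := by
    funext x
    refine (hasSum_synth r x.1 x.2 f).tsum_eq.symm.trans (tsum_congr fun p => ?_)
    rw [smul_smul]
  rw [e]
  have key := contDiff_tsum (𝕜 := ℝ) (N := (n : ℕ∞)) (v := fun _ p => ‖f p‖)
    (f := fun (p : ℤ × ℤ) (x : ℝ × ℝ) => (f p * (weight r p)⁻¹) • mode p x.1 x.2)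
    (fun p => (contDiff_mode p).const_smul _) (fun _ _ => f.summable_norm) ?_
  · exact key
  intro m p x hm
  have hm' : m ≤ n := by exact_mod_cast hm
  have hw := weight_pos r p
  rw [iteratedFDeriv_const_smul_apply' (contDiff_mode p).contDiffAt, norm_smul, norm_mul,
    norm_inv, Real.norm_of_nonneg hw.le, mul_assoc]
  refine mul_le_of_le_one_right (norm_nonneg _) ?_
  rw [inv_mul_le_one₀ hw]
  refine (norm_iteratedFDeriv_mode_le p m x).trans ?_
  refine le_trans ?_ (pow_le_weight (hm'.trans hr) p)
  exact pow_le_pow_left₀ (by positivity) (by linarith) m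

theorem hasDerivAt_mode_left (p : ℤ × ℤ) (t s : ℝ) :
    HasDerivAt (fun t => mode p t s) (Complex.I * p.1 * mode p t s) t := by
  have h := ((((Complex.ofRealCLM.hasDerivAt (x := t)).const_mul (p.1 : ℂ)).add_const
    ((p.2 : ℂ) * s)).const_mul Complex.I).cexp
  refine h.congr_deriv ?_
  simp [mode]; ring

theorem hasDerivAt_mode_right (p : ℤ × ℤ) (t s : ℝ) :
    HasDerivAt (fun s => mode p t s) (Complex.I * p.2 * mode p t s) s := by
  have h := ((((Complex.ofRealCLM.hasDerivAt (x := s)).const_mul (p.2 : ℂ)).const_add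
    ((p.1 : ℂ) * t)).const_mul Complex.I).cexp
  refine h.congr_deriv ?_
  simp [mode]; ring

theorem summable_smul_mode {a : ℤ × ℤ → ℝ} (ha : Summable fun p => ‖a p‖) {x : ℤ × ℤ → ℂ}
    {C : ℝ} (hx : ∀ p, ‖x p‖ ≤ C) (t s : ℝ) : Summable fun p => a p • (x p * mode p t s) := by
  refine Summable.of_norm_bounded (ha.mul_right C) fun p => ?_
  rw [norm_smul, norm_mul, norm_mode, mul_one]
  exact mul_le_mul_of_nonneg_left (hx p) (norm_nonneg _)

theorem hasDerivAt_tsum_mode_left {a : ℤ × ℤ → ℝ} (ha : Summable fun p => ‖a p‖)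
    {x : ℤ × ℤ → ℂ} {C : ℝ} (hx : ∀ p, ‖x p‖ ≤ C)
    (hx' : ∀ p : ℤ × ℤ, ‖x p * (Complex.I * p.1)‖ ≤ C) (t s : ℝ) :
    HasDerivAt (fun t => ∑' p, a p • (x p * mode p t s))
      (∑' p, a p • (x p * (Complex.I * p.1) * mode p t s)) t := by
  refine hasDerivAt_tsum (u := fun p => ‖a p‖ * C) (y₀ := (0 : ℝ))
    (g := fun p y => a p • (x p * mode p y s))
    (g' := fun p y => a p • (x p * (Complex.I * p.1) * mode p y s)) (ha.mul_right C)
    (fun p y => ?_) (fun p y => ?_) (summable_smul_mode ha hx 0 s) t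
  · rw [mul_assoc (x p)]
    exact ((hasDerivAt_mode_left p y s).const_mul (x p)).const_smul (a p)
  · rw [norm_smul, norm_mul, norm_mode, mul_one]
    exact mul_le_mul_of_nonneg_left (hx' p) (norm_nonneg _)

theorem hasDerivAt_tsum_mode_right {a : ℤ × ℤ → ℝ} (ha : Summable fun p => ‖a p‖)
    {x : ℤ × ℤ → ℂ} {C : ℝ} (hx : ∀ p, ‖x p‖ ≤ C)
    (hx' : ∀ p : ℤ × ℤ, ‖x p * (Complex.I * p.2)‖ ≤ C) (t s : ℝ) :
    HasDerivAt (fun s => ∑' p, a p • (x p * mode p t s))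
      (∑' p, a p • (x p * (Complex.I * p.2) * mode p t s)) s := by
  refine hasDerivAt_tsum (u := fun p => ‖a p‖ * C) (y₀ := (0 : ℝ))
    (g := fun p y => a p • (x p * mode p t y))
    (g' := fun p y => a p • (x p * (Complex.I * p.2) * mode p t y)) (ha.mul_right C)
    (fun p y => ?_) (fun p y => ?_) (summable_smul_mode ha hx t 0) s
  · rw [mul_assoc (x p)]
    exact ((hasDerivAt_mode_right p t y).const_mul (x p)).const_smul (a p)
  · rw [norm_smul, norm_mul, norm_mode, mul_one]
    exact mul_le_mul_of_nonneg_left (hx' p) (norm_nonneg _)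

theorem synth_eq_tsum (r : ℕ) (t s : ℝ) (f : Coeffs) :
    synth r t s f = ∑' p, f p • (((weight r p)⁻¹ : ℂ) * mode p t s) := by
  refine (hasSum_synth r t s f).tsum_eq.symm.trans (tsum_congr fun p => ?_)
  rw [Complex.real_smul (x := (weight r p)⁻¹), Complex.ofReal_inv]

/-- If `f` and `h` are related by the symbol of `L(ω)`, then so are the functions. -/
theorem linOp_synth {r : ℕ} (hr : 2 ≤ r) {q : ℤ} {ω : ℝ} {f h : Coeffs}
    (hfh : ∀ p : ℤ × ℤ, ((p.1 : ℝ) / q + (p.2 : ℝ) ^ 2 + ω) * f p + ω * f (-p) = h p) (t s : ℝ) :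
    linOp q ω (fun t s => synth r t s f) t s = synth r t s h := by
  have hw : ∀ p, ‖((weight r p)⁻¹ : ℂ)‖ = (weight r p)⁻¹ := fun p => by
    rw [norm_inv, Complex.norm_real, Real.norm_of_nonneg (weight_pos r p).le]
  have hj : ∀ p : ℤ × ℤ, |(p.1 : ℝ)| ≤ weight r p := fun p =>
    le_trans (by linarith [abs_nonneg (p.2 : ℝ)]) (pow_le_weight (n := 1) (by omega) p)
  have hk : ∀ p : ℤ × ℤ, |(p.2 : ℝ)| ≤ weight r p := fun p =>
    le_trans (by linarith [abs_nonneg (p.1 : ℝ)]) (pow_le_weight (n := 1) (by omega) p)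
  have hkk : ∀ p : ℤ × ℤ, |(p.2 : ℝ)| * |(p.2 : ℝ)| ≤ weight r p := fun p =>
    le_trans (by nlinarith [abs_nonneg (p.1 : ℝ), abs_nonneg (p.2 : ℝ)])
      (pow_le_weight (n := 2) hr p)
  have h0 : ∀ p, ‖((weight r p)⁻¹ : ℂ)‖ ≤ 1 := fun p => by
    rw [hw]; exact inv_le_one_of_one_le₀ (one_le_weight r p)
  have h1 : ∀ p : ℤ × ℤ, ‖((weight r p)⁻¹ : ℂ) * (Complex.I * p.1)‖ ≤ 1 := fun p => by
    rw [norm_mul, hw, norm_mul, Complex.norm_I, one_mul, Complex.norm_intCast,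
      inv_mul_le_one₀ (weight_pos r p)]
    exact hj p
  have h2 : ∀ p : ℤ × ℤ, ‖((weight r p)⁻¹ : ℂ) * (Complex.I * p.2)‖ ≤ 1 := fun p => by
    rw [norm_mul, hw, norm_mul, Complex.norm_I, one_mul, Complex.norm_intCast,
      inv_mul_le_one₀ (weight_pos r p)]
    exact hk p
  -- The second `s`-derivative costs `k²`; this is where the weight must have degree at least two.
  have h3 : ∀ p : ℤ × ℤ,
      ‖((weight r p)⁻¹ : ℂ) * (Complex.I * p.2) * (Complex.I * p.2)‖ ≤ 1 := fun p => by
    rw [mul_assoc, norm_mul, hw, norm_mul, norm_mul, Complex.norm_I, one_mul,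
      Complex.norm_intCast, inv_mul_le_one₀ (weight_pos r p)]
    exact hkk p
  have hconj : conj (synth r t s f)
      = ∑' p, f (-p) • (((weight r p)⁻¹ : ℂ) * mode p t s) := by
    rw [← synth_conjCoeffs, synth_eq_tsum]
    exact tsum_congr fun p => by rw [conjCoeffs_apply]
  have d2 : iteratedDeriv 2 (fun s' => ∑' p, f p • (((weight r p)⁻¹ : ℂ) * mode p t s')) s
      = ∑' p, f p • (((weight r p)⁻¹ : ℂ) * (Complex.I * p.2) * (Complex.I * p.2)
          * mode p t s) := by
    rw [iteratedDeriv_succ, iteratedDeriv_one]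
    have : deriv (fun s' => ∑' p, f p • (((weight r p)⁻¹ : ℂ) * mode p t s'))
        = fun s' => ∑' p, f p • (((weight r p)⁻¹ : ℂ) * (Complex.I * p.2) * mode p t s') :=
      funext fun s' => (hasDerivAt_tsum_mode_right f.summable_norm h0 h2 t s').deriv
    rw [this]
    exact (hasDerivAt_tsum_mode_right f.summable_norm h2 h3 t s).deriv
  have d1 : deriv (fun t' => synth r t' s f) t
      = ∑' p, f p • (((weight r p)⁻¹ : ℂ) * (Complex.I * p.1) * mode p t s) := by
    rw [funext fun t' => synth_eq_tsum r t' s f]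
    exact (hasDerivAt_tsum_mode_left f.summable_norm h0 h1 t s).deriv
  have d2' : iteratedDeriv 2 (fun s' => synth r t s' f) s
      = ∑' p, f p • (((weight r p)⁻¹ : ℂ) * (Complex.I * p.2) * (Complex.I * p.2)
          * mode p t s) := by
    rw [funext fun s' => synth_eq_tsum r t s' f]
    exact d2
  change -(Complex.I / (q : ℂ)) * deriv (fun t' => synth r t' s f) t
    - iteratedDeriv 2 (fun s' => synth r t s' f) s
    + (ω : ℂ) * (synth r t s f + conj (synth r t s f)) = _
  rw [d1, d2', hconj, synth_eq_tsum r t s f, synth_eq_tsum r t s h]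
  have s0 : Summable fun p => f p • (((weight r p)⁻¹ : ℂ) * mode p t s) :=
    summable_smul_mode f.summable_norm h0 t s
  have s1 := summable_smul_mode f.summable_norm h1 t s
  have s3 := summable_smul_mode f.summable_norm h3 t s
  have sc : Summable fun p => f (-p) • (((weight r p)⁻¹ : ℂ) * mode p t s) :=
    (summable_smul_mode (conjCoeffs f).summable_norm h0 t s).congr fun p => by rw [conjCoeffs_apply]
  refine (((s1.hasSum.mul_left _).sub s3.hasSum).add
    ((s0.hasSum.add sc.hasSum).mul_left _)).tsum_eq.symm.trans (tsum_congr fun p => ?_)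
  rw [← hfh p]
  simp only [Complex.real_smul]
  push_cast
  have hI := Complex.I_mul_I
  linear_combination (f p * (weight r p : ℂ)⁻¹ * mode p t s) *
    (-(p.1 : ℂ) / q - (p.2 : ℂ) ^ 2) * hI

/-! ### Fourier coefficients and Sobolev norms -/

theorem integral_cexp_int (m : ℤ) :
    ∫ x in (0 : ℝ)..(2 * Real.pi), Complex.exp (Complex.I * (m * (x : ℂ)))
      = if m = 0 then 2 * (Real.pi : ℂ) else 0 := by
  split_ifs with h
  · simp [h]
  · have hc : Complex.I * (m : ℂ) ≠ 0 := by simp [h]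
    have := integral_exp_mul_complex (a := 0) (b := 2 * Real.pi) hc
    simp only [← mul_assoc] at this ⊢
    rw [this]
    have e : Complex.exp (Complex.I * m * ((2 * Real.pi : ℝ) : ℂ)) = 1 := by
      rw [Complex.exp_eq_one_iff]
      exact ⟨m, by push_cast; ring⟩
    rw [e]
    simp

/-- Orthogonality of the modes, after exchanging sum and integral by dominated convergence in `s`
and then in `t`. -/
theorem torusCoeff_synth (r : ℕ) (f : Coeffs) (j k : ℤ) :
    torusCoeff (fun t s => synth r t s f) j k = ((f (j, k) / weight r (j, k) : ℝ) : ℂ) := by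
  set c : ℤ × ℤ → ℂ := fun p => ((f p / weight r p : ℝ) : ℂ) with hc
  have hcn : ∀ p, ‖c p‖ ≤ ‖f p‖ := fun p => by
    rw [hc, Complex.norm_real, norm_div, Real.norm_of_nonneg (weight_pos r p).le]
    exact div_le_self (norm_nonneg _) (one_le_weight r p)
  have hcs : Summable fun p => ‖c p‖ :=
    Summable.of_nonneg_of_le (fun _ => norm_nonneg _) hcn f.summable_norm
  set E : ℤ → ℝ → ℂ := fun m x => Complex.exp (Complex.I * (m * (x : ℂ))) with hE
  have hEn : ∀ m x, ‖E m x‖ = 1 := fun m x => by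
    have : E m x = Complex.exp (((m * x : ℝ) : ℂ) * Complex.I) := by
      rw [hE]; push_cast; ring_nf
    rw [this, Complex.norm_exp_ofReal_mul_I]
  have hEc : ∀ m, Continuous (E m) := fun m => by rw [hE]; fun_prop
  have hprod : ∀ (p : ℤ × ℤ) (t s : ℝ), mode p t s
      * Complex.exp (-Complex.I * ((j : ℂ) * (t : ℂ) + (k : ℂ) * (s : ℂ)))
        = E (p.1 - j) t * E (p.2 - k) s := fun p t s => by
    rw [hE, mode, ← Complex.exp_add, ← Complex.exp_add]
    push_cast
    ring_nf
  have hpt : ∀ t s : ℝ, HasSum (fun p => c p * E (p.1 - j) t * E (p.2 - k) s)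
      (synth r t s f * Complex.exp (-Complex.I * ((j : ℂ) * (t : ℂ) + (k : ℂ) * (s : ℂ)))) := by
    intro t s
    convert! (hasSum_synth r t s f).mul_right
      (Complex.exp (-Complex.I * ((j : ℂ) * (t : ℂ) + (k : ℂ) * (s : ℂ)))) using 2 with p
    rw [smul_smul, Complex.real_smul, mul_assoc, mul_assoc, hprod, ← div_eq_mul_inv]
  have hin : ∀ t : ℝ, HasSum (fun p : ℤ × ℤ =>
      c p * E (p.1 - j) t * (if p.2 - k = 0 then 2 * (Real.pi : ℂ) else 0))
      (∫ s in (0 : ℝ)..(2 * Real.pi), synth r t s f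
        * Complex.exp (-Complex.I * ((j : ℂ) * (t : ℂ) + (k : ℂ) * (s : ℂ)))) := by
    intro t
    have := intervalIntegral.hasSum_integral_of_dominated_convergence (μ := MeasureTheory.volume)
      (a := 0) (b := 2 * Real.pi)
      (F := fun p s => c p * E (p.1 - j) t * E (p.2 - k) s)
      (f := fun s => synth r t s f
        * Complex.exp (-Complex.I * ((j : ℂ) * (t : ℂ) + (k : ℂ) * (s : ℂ))))
      (bound := fun p _ => ‖c p‖)
      (fun p => (continuous_const.mul (hEc _)).aestronglyMeasurable)
      (fun p => Filter.Eventually.of_forall fun s _ => by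
        rw [norm_mul, norm_mul, hEn, hEn, mul_one, mul_one])
      (Filter.Eventually.of_forall fun s _ => hcs)
      (by simp) (Filter.Eventually.of_forall fun s _ => hpt t s)
    convert! this using 2 with p
    rw [intervalIntegral.integral_const_mul, hE, integral_cexp_int]
  have hout : HasSum (fun p : ℤ × ℤ =>
      c p * (if p.1 - j = 0 then 2 * (Real.pi : ℂ) else 0)
        * (if p.2 - k = 0 then 2 * (Real.pi : ℂ) else 0))
      (∫ t in (0 : ℝ)..(2 * Real.pi), ∫ s in (0 : ℝ)..(2 * Real.pi), synth r t s f
        * Complex.exp (-Complex.I * ((j : ℂ) * (t : ℂ) + (k : ℂ) * (s : ℂ)))) := by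
    have := intervalIntegral.hasSum_integral_of_dominated_convergence (μ := MeasureTheory.volume)
      (a := 0) (b := 2 * Real.pi)
      (F := fun (p : ℤ × ℤ) t => c p * E (p.1 - j) t
        * (if p.2 - k = 0 then 2 * (Real.pi : ℂ) else 0))
      (f := fun t => ∫ s in (0 : ℝ)..(2 * Real.pi), synth r t s f
        * Complex.exp (-Complex.I * ((j : ℂ) * (t : ℂ) + (k : ℂ) * (s : ℂ))))
      (bound := fun p _ => ‖c p‖ * (2 * Real.pi))
      (fun p => ((continuous_const.mul (hEc _)).mul continuous_const).aestronglyMeasurable)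
      (fun p => Filter.Eventually.of_forall fun s _ => by
        rw [norm_mul, norm_mul, hEn, mul_one]
        gcongr
        split_ifs
        · simp [abs_of_pos Real.pi_pos]
        · simp [Real.pi_pos.le])
      (Filter.Eventually.of_forall fun s _ => hcs.mul_right _)
      (by simp) (Filter.Eventually.of_forall fun t _ => hin t)
    convert! this using 2 with p
    rw [intervalIntegral.integral_mul_const, intervalIntegral.integral_const_mul, hE,
      integral_cexp_int]
  have hval : HasSum (fun p : ℤ × ℤ =>
      c p * (if p.1 - j = 0 then 2 * (Real.pi : ℂ) else 0)
        * (if p.2 - k = 0 then 2 * (Real.pi : ℂ) else 0)) (c (j, k) * (2 * (Real.pi : ℂ)) ^ 2) := by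
    convert! hasSum_ite_eq (j, k) (c (j, k) * (2 * (Real.pi : ℂ)) ^ 2) using 2 with p
    obtain ⟨a, b⟩ := p
    by_cases h1 : a = j
    · by_cases h2 : b = k
      · simp [h1, h2]; ring
      · simp [h2, sub_eq_zero]
    · simp [h1, sub_eq_zero]
  rw [torusCoeff, hout.unique hval]
  have hπ : (2 * (Real.pi : ℂ)) ≠ 0 := by simp [Real.pi_ne_zero]
  field_simp
  rfl

/-- The Sobolev weight is at most `weight r p ^ 2`, so the squared norm is at most `∑ |f p|²`, and
this is at most the square of the `ℓ¹` norm. -/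
theorem sobolevNorm_synth_le {σ : ℝ} {r : ℕ} (hσ : 0 ≤ σ) (hr : σ ≤ r) (f : Coeffs) :
    sobolevNorm σ (fun t s => synth r t s f) ≤ ENNReal.ofReal ‖f‖ := by
  have hterm : ∀ p : ℤ × ℤ, ‖torusCoeff (fun t s => synth r t s f) p.1 p.2‖ ^ 2
      * ((p.1 : ℝ) ^ 2 + (p.2 : ℝ) ^ 2 + 1) ^ σ ≤ ‖f p‖ * ‖f‖ := by
    intro p
    have hw := weight_pos r p
    set a : ℝ := 1 + |(p.1 : ℝ)| + |(p.2 : ℝ)| with ha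
    have ha1 : 1 ≤ a := by linarith [abs_nonneg (p.1 : ℝ), abs_nonneg (p.2 : ℝ)]
    have hpow : ((p.1 : ℝ) ^ 2 + (p.2 : ℝ) ^ 2 + 1) ^ σ ≤ weight r p ^ 2 := by
      calc ((p.1 : ℝ) ^ 2 + (p.2 : ℝ) ^ 2 + 1) ^ σ ≤ (a ^ 2) ^ σ := by
            refine Real.rpow_le_rpow (by positivity) ?_ hσ
            rw [← sq_abs (p.1 : ℝ), ← sq_abs (p.2 : ℝ), ha]
            nlinarith [abs_nonneg (p.1 : ℝ), abs_nonneg (p.2 : ℝ),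
              mul_nonneg (abs_nonneg (p.1 : ℝ)) (abs_nonneg (p.2 : ℝ))]
        _ ≤ (a ^ 2) ^ (r : ℝ) := Real.rpow_le_rpow_of_exponent_le (one_le_pow₀ ha1) hr
        _ = weight r p ^ 2 := by rw [Real.rpow_natCast, weight, ← pow_mul, ← pow_mul, mul_comm]
    have hc : ‖torusCoeff (fun t s => synth r t s f) p.1 p.2‖ = ‖f p‖ / weight r p := by
      rw [torusCoeff_synth, Complex.norm_real, norm_div, Real.norm_of_nonneg hw.le]
    rw [hc]
    calc (‖f p‖ / weight r p) ^ 2 * ((p.1 : ℝ) ^ 2 + (p.2 : ℝ) ^ 2 + 1) ^ σ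
        ≤ (‖f p‖ / weight r p) ^ 2 * weight r p ^ 2 := by gcongr
      _ = ‖f p‖ * ‖f p‖ := by field_simp
      _ ≤ ‖f p‖ * ‖f‖ := by gcongr; exact f.norm_apply_le p
  have hsum : (∑' p : ℤ × ℤ, ENNReal.ofReal
      (‖torusCoeff (fun t s => synth r t s f) p.1 p.2‖ ^ 2
        * ((p.1 : ℝ) ^ 2 + (p.2 : ℝ) ^ 2 + 1) ^ σ)) ≤ ENNReal.ofReal ‖f‖ ^ 2 := by
    calc _ ≤ ∑' p : ℤ × ℤ, ENNReal.ofReal (‖f p‖ * ‖f‖) :=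
          ENNReal.tsum_le_tsum fun p => ENNReal.ofReal_le_ofReal (hterm p)
      _ = ENNReal.ofReal (∑' p : ℤ × ℤ, ‖f p‖ * ‖f‖) :=
          (ENNReal.ofReal_tsum_of_nonneg (fun p => by positivity)
            (f.summable_norm.mul_right _)).symm
      _ = ENNReal.ofReal ‖f‖ ^ 2 := by
          rw [tsum_mul_right, ← f.norm_eq_tsum, ← sq, ENNReal.ofReal_pow (norm_nonneg _)]
  calc sobolevNorm σ (fun t s => synth r t s f) ≤ (ENNReal.ofReal ‖f‖ ^ 2) ^ (1 / 2 : ℝ) :=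
        ENNReal.rpow_le_rpow hsum (by norm_num)
    _ = ENNReal.ofReal ‖f‖ := by
        rw [← ENNReal.rpow_natCast, ← ENNReal.rpow_mul]; norm_num

/-! ### Small divisors -/

/-- The determinant of the symbol of `L(ω₀)` on the frequencies `±(j, k)`, cleared of
denominators. -/
def resonance (q : ℤ) (k₀ : ℕ) (p : ℤ × ℤ) : ℤ :=
  (k₀ : ℤ) ^ 2 * ((q * p.2 ^ 2 - 1) ^ 2 - p.1 ^ 2 - 1) + p.2 ^ 2

/-- The frequencies at which the symbol of `L(ω₀)` degenerates. -/
def resonantSet (q : ℤ) (k₀ : ℕ) : Finset (ℤ × ℤ) :=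
  {(0, 0), (j0 q k₀, (k₀ : ℤ)), (j0 q k₀, -(k₀ : ℤ)), (-j0 q k₀, (k₀ : ℤ)),
    (-j0 q k₀, -(k₀ : ℤ))}

theorem sq_le_abs_mul_sq_sub_one {q : ℤ} (hq : q ≠ 0) (k : ℤ) : k ^ 2 ≤ |q * k ^ 2 - 1| + 1 := by
  have h1 : 1 ≤ |q| := Int.one_le_abs hq
  have h2 : |q * k ^ 2| ≤ |q * k ^ 2 - 1| + 1 := by
    have := abs_add_le (q * k ^ 2 - 1) 1
    simpa using this
  rw [abs_mul, abs_of_nonneg (sq_nonneg k)] at h2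
  nlinarith [sq_nonneg k]

/-- With `m = |q k² - 1|`, `a = |j|` and `κ = k₀²`, the resonance is `κ (m² - a² - 1) + k²`. If `a ≠
m`, integrality gives `|m² - a²| ≥ m + a`, and `k² ≤ m + 1` prevents the remaining terms from
cancelling this, except at the origin. If `a = m`, the value is `k² - κ`, an integer that vanishes
only for `k = ±k₀` and grows like `k²`, hence like `|j|`. -/
theorem resonance_eq_zero_or_le {q : ℤ} (hq : q ≠ 0) {k₀ : ℕ} (hk₀ : 0 < k₀) (p : ℤ × ℤ) :
    (resonance q k₀ p = 0 ∧ p ∈ resonantSet q k₀) ∨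
      1 + p.2 ^ 2 + |p.1| ≤ ((|q| + 1) * ((k₀ : ℤ) ^ 2 + 1) + 2) * |resonance q k₀ p| := by
  obtain ⟨j, k⟩ := p
  have hk : (1 : ℤ) ≤ (k₀ : ℤ) ^ 2 := one_le_pow₀ (by exact_mod_cast hk₀)
  have hq1 : 1 ≤ |q| := Int.one_le_abs hq
  set m := |q * k ^ 2 - 1| with hm
  set a := |j| with ha
  set κ := (k₀ : ℤ) ^ 2 with hκ
  have hkm : k ^ 2 ≤ m + 1 := sq_le_abs_mul_sq_sub_one hq k
  have hm0 : 0 ≤ m := abs_nonneg _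
  have ha0 : 0 ≤ a := abs_nonneg _
  have hN : resonance q k₀ (j, k) = κ * (m ^ 2 - a ^ 2 - 1) + k ^ 2 := by
    simp only [resonance, hm, ha, sq_abs, hκ]
  have hD : 6 ≤ (|q| + 1) * (κ + 1) + 2 := by nlinarith
  have hk2 := sq_nonneg k
  rcases lt_trichotomy a m with h | h | h
  · -- below the resonant curve
    have h1 : a + m ≤ m ^ 2 - a ^ 2 := by nlinarith
    have h2 : a + k ^ 2 ≤ resonance q k₀ (j, k) := by rw [hN]; nlinarith
    rcases eq_or_ne k 0 with rfl | hk'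
    · left
      have hm1 : m = 1 := by simp [hm]
      have ha' : a = 0 := by omega
      have hj : j = 0 := by simpa [ha] using ha'
      exact ⟨by rw [hN, hm1, ha']; ring, by simp [resonantSet, hj]⟩
    · right
      have h3 : 0 < k ^ 2 := by positivity
      have h4 : 0 < resonance q k₀ (j, k) := by linarith
      rw [abs_of_pos h4]
      change 1 + k ^ 2 + a ≤ _
      nlinarith
  · -- on the resonant curve
    have hN' : resonance q k₀ (j, k) = k ^ 2 - κ := by rw [hN, h]; ring
    rcases eq_or_ne (k ^ 2) κ with hkk | hkk
    · left
      refine ⟨by rw [hN', hkk, sub_self], ?_⟩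
      have hm' : |q * k ^ 2 - 1| = |j0 q k₀| := by rw [hkk, j0]
      have hj := abs_eq_abs.1 (h.trans hm')
      have hk' := sq_eq_sq_iff_eq_or_eq_neg.1 hkk
      rcases hj with rfl | rfl <;> rcases hk' with rfl | rfl <;> simp [resonantSet]
    · right
      rw [hN']
      have h1 : 1 ≤ |k ^ 2 - κ| := Int.one_le_abs (sub_ne_zero.2 hkk)
      have h2 : k ^ 2 ≤ (κ + 1) * |k ^ 2 - κ| := by
        rcases abs_cases (k ^ 2 - κ) with h | h <;> nlinarith
      have h3 : m ≤ |q| * k ^ 2 + 1 := by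
        have := abs_sub (q * k ^ 2) 1
        rw [abs_mul, abs_of_nonneg hk2] at this
        simpa using this
      change 1 + k ^ 2 + a ≤ _
      nlinarith
  · -- above the resonant curve
    right
    have h1 : a + m ≤ a ^ 2 - m ^ 2 := by nlinarith
    have h2 : a ≤ - resonance q k₀ (j, k) := by rw [hN]; nlinarith
    have h3 : - resonance q k₀ (j, k) ≤ |resonance q k₀ (j, k)| := neg_le_abs _
    change 1 + k ^ 2 + a ≤ _
    nlinarith

/-! ### The frequency `ω₀` and the symbol at the resonant frequencies -/

section Algebra

variable {q : ℤ} {k₀ : ℕ}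

theorem omega0_eq (hq : q ≠ 0) (hk₀ : 0 < k₀) :
    omega0 q k₀ = -(2 * (k₀ : ℝ) ^ 2 * q - 1) / (2 * (k₀ : ℝ) ^ 2 * (q : ℝ) ^ 2) := by
  have h1 : (q : ℝ) ≠ 0 := by exact_mod_cast hq
  have h2 : (k₀ : ℝ) ≠ 0 := by positivity
  rw [omega0]
  field_simp

/-- An odd integer is not zero. -/
theorem two_mul_sq_mul_sub_one_ne_zero (q : ℤ) (k₀ : ℕ) : 2 * (k₀ : ℝ) ^ 2 * q - 1 ≠ 0 := by
  intro h
  have : 2 * (k₀ : ℤ) ^ 2 * q = 1 := by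
    have : 2 * (k₀ : ℝ) ^ 2 * q = 1 := by linarith
    exact_mod_cast this
  have h2 : (2 : ℤ) ∣ 1 := ⟨(k₀ : ℤ) ^ 2 * q, by rw [← this]; ring⟩
  norm_num at h2

theorem omega0_ne_zero (hq : q ≠ 0) (hk₀ : 0 < k₀) : omega0 q k₀ ≠ 0 := by
  have h1 : (q : ℝ) ≠ 0 := by exact_mod_cast hq
  have h2 : (k₀ : ℝ) ≠ 0 := by positivity
  rw [omega0_eq hq hk₀]
  exact div_ne_zero (neg_ne_zero.2 (two_mul_sq_mul_sub_one_ne_zero q k₀)) (by positivity)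

theorem omega0_neg (hq : 0 < q) (hk₀ : 0 < k₀) : omega0 q k₀ < 0 := by
  have h1 : (1 : ℝ) ≤ q := by exact_mod_cast hq
  have h2 : (1 : ℝ) ≤ k₀ := by exact_mod_cast hk₀
  have h3 : (1 : ℝ) ≤ (k₀ : ℝ) ^ 2 := one_le_pow₀ h2
  rw [omega0_eq hq.ne' hk₀]
  exact div_neg_of_neg_of_pos (by nlinarith) (by positivity)

theorem det_eq_resonance (hq : q ≠ 0) (hk₀ : 0 < k₀) (p : ℤ × ℤ) :
    ((p.2 : ℝ) ^ 2 + omega0 q k₀) ^ 2 - ((p.1 : ℝ) / q) ^ 2 - omega0 q k₀ ^ 2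
      = resonance q k₀ p / ((q : ℝ) ^ 2 * (k₀ : ℝ) ^ 2) := by
  have h1 : (q : ℝ) ≠ 0 := by exact_mod_cast hq
  have h2 : (k₀ : ℝ) ≠ 0 := by positivity
  rw [omega0_eq hq hk₀, resonance]
  push_cast
  field_simp
  ring

/-- Put `N = k₀² q`. With `symbol_add_eq` and `omega0_eq`, the block at `±(j₀, k₀)` is `1 / (2 k₀²
q²)` times the rank-one matrix with rows `((2N - 1)², -(2N - 1))` and `(-(2N - 1), 1)`. Its kernel
is spanned by `(1, 2N - 1)`, whence the weights in `kernelFunctional`. -/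
theorem symbol_sub_eq (hq : q ≠ 0) (hk₀ : 0 < k₀) :
    (k₀ : ℝ) ^ 2 + omega0 q k₀ - (j0 q k₀ : ℝ) / q = 1 / (2 * (k₀ : ℝ) ^ 2 * (q : ℝ) ^ 2) := by
  have h1 : (q : ℝ) ≠ 0 := by exact_mod_cast hq
  have h2 : (k₀ : ℝ) ≠ 0 := by positivity
  rw [omega0_eq hq hk₀, j0]
  push_cast
  field_simp
  ring

theorem symbol_add_eq (hq : q ≠ 0) (hk₀ : 0 < k₀) :
    (k₀ : ℝ) ^ 2 + omega0 q k₀ + (j0 q k₀ : ℝ) / q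
      = (2 * (k₀ : ℝ) ^ 2 * q - 1) ^ 2 / (2 * (k₀ : ℝ) ^ 2 * (q : ℝ) ^ 2) := by
  have h1 : (q : ℝ) ≠ 0 := by exact_mod_cast hq
  have h2 : (k₀ : ℝ) ≠ 0 := by positivity
  rw [omega0_eq hq hk₀, j0]
  push_cast
  field_simp
  ring

/-- Twice this number is the trace of the singular block, by which the pseudoinverse divides. -/
theorem sq_add_omega0_pos (hq : q ≠ 0) (hk₀ : 0 < k₀) : 0 < (k₀ : ℝ) ^ 2 + omega0 q k₀ := by
  have h1 : (q : ℝ) ≠ 0 := by exact_mod_cast hq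
  have h2 : (k₀ : ℝ) ≠ 0 := by positivity
  have h := symbol_sub_eq hq hk₀
  have h' := symbol_add_eq hq hk₀
  have h3 : 0 < 1 / (2 * (k₀ : ℝ) ^ 2 * (q : ℝ) ^ 2) := by positivity
  have h4 : 0 ≤ (2 * (k₀ : ℝ) ^ 2 * q - 1) ^ 2 / (2 * (k₀ : ℝ) ^ 2 * (q : ℝ) ^ 2) := by positivity
  linarith

theorem resonance_eq_zero_of_mem {p : ℤ × ℤ}
    (hp : p ∈ resonantSet q k₀) : resonance q k₀ p = 0 := by
  simp only [resonantSet, Finset.mem_insert, Finset.mem_singleton] at hp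
  rcases hp with rfl | rfl | rfl | rfl | rfl <;> simp only [resonance, j0] <;> ring

end Algebra

/-! ### The partial inverse of the linearization -/

/-- The functional whose kernel is the range of `L(ω₀)` among even families. -/
def kernelFunctional (q : ℤ) (k₀ : ℕ) : Coeffs →L[ℝ] ℝ :=
  coord (j0 q k₀, (k₀ : ℤ)) + (2 * (k₀ : ℝ) ^ 2 * q - 1) • coord (-j0 q k₀, -(k₀ : ℤ))

theorem kernelFunctional_apply (q : ℤ) (k₀ : ℕ) (f : Coeffs) : kernelFunctional q k₀ f
    = f (j0 q k₀, (k₀ : ℤ)) + (2 * (k₀ : ℝ) ^ 2 * q - 1) * f (-j0 q k₀, -(k₀ : ℤ)) := by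
  simp [kernelFunctional, coord_apply]

theorem exists_forall_abs_le_of_finset {x : ℤ × ℤ → ℝ} (S : Finset (ℤ × ℤ)) (C : ℝ)
    (h : ∀ p ∉ S, |x p| ≤ C) : ∃ C', ∀ p, |x p| ≤ C' := by
  refine ⟨max C (∑ p ∈ S, |x p|), fun p => ?_⟩
  by_cases hp : p ∈ S
  · exact (Finset.single_le_sum (f := fun p => |x p|) (fun _ _ => abs_nonneg _) hp).trans
      (le_max_right _ _)
  · exact (h p hp).trans (le_max_left _ _)

/-- The diagonal multiplier of the partial inverse. -/
def resolventDiag (q : ℤ) (k₀ : ℕ) (p : ℤ × ℤ) : ℝ :=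
  if resonance q k₀ p = 0 then
    ((p.2 : ℝ) ^ 2 + omega0 q k₀ + (p.1 : ℝ) / q) / (2 * ((p.2 : ℝ) ^ 2 + omega0 q k₀)) ^ 2
  else
    ((p.2 : ℝ) ^ 2 + omega0 q k₀ - (p.1 : ℝ) / q)
      / (((p.2 : ℝ) ^ 2 + omega0 q k₀) ^ 2 - ((p.1 : ℝ) / q) ^ 2 - omega0 q k₀ ^ 2)

/-- The multiplier of the partial inverse that couples `p` with `-p`. -/
def resolventOff (q : ℤ) (k₀ : ℕ) (p : ℤ × ℤ) : ℝ :=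
  if resonance q k₀ p = 0 then
    omega0 q k₀ / (2 * ((p.2 : ℝ) ^ 2 + omega0 q k₀)) ^ 2
  else
    -omega0 q k₀ / (((p.2 : ℝ) ^ 2 + omega0 q k₀) ^ 2 - ((p.1 : ℝ) / q) ^ 2 - omega0 q k₀ ^ 2)

/-- The numerators are `O(1 + k² + |j|)`, which the lower bound on the determinant matches; the
finitely many resonant frequencies only change the constant. -/
theorem resolvent_bounded {q : ℤ} (hq : q ≠ 0) {k₀ : ℕ} (hk₀ : 0 < k₀) :
    (∃ C, ∀ p, |resolventDiag q k₀ p| ≤ C) ∧ ∃ C, ∀ p, |resolventOff q k₀ p| ≤ C := by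
  have h1 : (q : ℝ) ≠ 0 := by exact_mod_cast hq
  have h2 : (k₀ : ℝ) ≠ 0 := by positivity
  set D : ℝ := (|(q : ℝ)| + 1) * ((k₀ : ℝ) ^ 2 + 1) + 2 with hD
  set ω := omega0 q k₀
  have main : ∀ p ∉ resonantSet q k₀, ∀ x : ℝ,
      |x| ≤ (1 + |ω|) * (1 + (p.2 : ℝ) ^ 2 + |(p.1 : ℝ)|) →
      resonance q k₀ p ≠ 0 ∧
      |x / (((p.2 : ℝ) ^ 2 + ω) ^ 2 - ((p.1 : ℝ) / q) ^ 2 - ω ^ 2)|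
        ≤ (1 + |ω|) * D * ((q : ℝ) ^ 2 * (k₀ : ℝ) ^ 2) := by
    intro p hp x hx
    rcases resonance_eq_zero_or_le hq hk₀ p with h | h
    · exact absurd h.2 hp
    have hr : resonance q k₀ p ≠ 0 := by
      intro h0
      rw [h0, abs_zero, mul_zero] at h
      have := sq_nonneg p.2
      have := abs_nonneg p.1
      omega
    refine ⟨hr, ?_⟩
    have h' : 1 + (p.2 : ℝ) ^ 2 + |(p.1 : ℝ)| ≤ D * |(resonance q k₀ p : ℝ)| := by
      rw [hD]; exact_mod_cast h
    have hr' : 0 < |(resonance q k₀ p : ℝ)| := abs_pos.2 (by exact_mod_cast hr)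
    rw [det_eq_resonance hq hk₀, abs_div, abs_div,
      abs_of_pos (show 0 < (q : ℝ) ^ 2 * (k₀ : ℝ) ^ 2 by positivity), div_div_eq_mul_div,
      div_le_iff₀ hr']
    calc |x| * ((q : ℝ) ^ 2 * (k₀ : ℝ) ^ 2)
        ≤ ((1 + |ω|) * (D * |(resonance q k₀ p : ℝ)|)) * ((q : ℝ) ^ 2 * (k₀ : ℝ) ^ 2) := by
          gcongr
          exact hx.trans (by gcongr)
      _ = _ := by ring
  constructor
  · refine exists_forall_abs_le_of_finset (resonantSet q k₀)
      ((1 + |ω|) * D * ((q : ℝ) ^ 2 * (k₀ : ℝ) ^ 2)) fun p hp => ?_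
    have hx : |(p.2 : ℝ) ^ 2 + ω - (p.1 : ℝ) / q|
        ≤ (1 + |ω|) * (1 + (p.2 : ℝ) ^ 2 + |(p.1 : ℝ)|) := by
      have hq1 : 1 ≤ |(q : ℝ)| := by exact_mod_cast Int.one_le_abs hq
      have ha : |(p.1 : ℝ) / q| ≤ |(p.1 : ℝ)| := by
        rw [abs_div]; exact div_le_self (abs_nonneg _) hq1
      have hb := abs_sub ((p.2 : ℝ) ^ 2 + ω) ((p.1 : ℝ) / q)
      have hc := abs_add_le ((p.2 : ℝ) ^ 2) ω
      rw [abs_of_nonneg (sq_nonneg (p.2 : ℝ))] at hc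
      have := mul_nonneg (abs_nonneg ω) (add_nonneg (sq_nonneg (p.2 : ℝ)) (abs_nonneg (p.1 : ℝ)))
      nlinarith
    obtain ⟨hr, h⟩ := main p hp _ hx
    rw [resolventDiag, if_neg hr]
    exact h
  · refine exists_forall_abs_le_of_finset (resonantSet q k₀)
      ((1 + |ω|) * D * ((q : ℝ) ^ 2 * (k₀ : ℝ) ^ 2)) fun p hp => ?_
    have hx : |-ω| ≤ (1 + |ω|) * (1 + (p.2 : ℝ) ^ 2 + |(p.1 : ℝ)|) := by
      rw [abs_neg]
      have := mul_nonneg (abs_nonneg ω) (add_nonneg (sq_nonneg (p.2 : ℝ)) (abs_nonneg (p.1 : ℝ)))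
      nlinarith [sq_nonneg (p.2 : ℝ), abs_nonneg (p.1 : ℝ)]
    obtain ⟨hr, h⟩ := main p hp _ hx
    rw [resolventOff, if_neg hr]
    exact h

theorem resonance_neg (q : ℤ) (k₀ : ℕ) (p : ℤ × ℤ) : resonance q k₀ (-p) = resonance q k₀ p := by
  simp [resonance]

theorem resonance_flip (q : ℤ) (k₀ : ℕ) (p : ℤ × ℤ) :
    resonance q k₀ (p.1, -p.2) = resonance q k₀ p := by
  simp [resonance]

theorem apply_flip_of_even {f : Coeffs} (hf : flipCoeffs f = f) (j k : ℤ) :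
    f (j, -k) = f (j, k) := by
  have := flipCoeffs_apply f (j, k)
  rw [hf] at this
  exact this.symm

theorem block_inverse {A J ω : ℝ} (hd : A ^ 2 - J ^ 2 - ω ^ 2 ≠ 0) (x y : ℝ) :
    (J + A) * ((A - J) / (A ^ 2 - J ^ 2 - ω ^ 2) * x + -ω / (A ^ 2 - J ^ 2 - ω ^ 2) * y)
      + ω * ((A + J) / (A ^ 2 - J ^ 2 - ω ^ 2) * y + -ω / (A ^ 2 - J ^ 2 - ω ^ 2) * x) = x := by
  field_simp
  ring

/-- A symmetric matrix `M` of rank one with trace `τ` satisfies `M² = τ M`, so `M / τ²` inverts it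
on its range. Here `τ = 2 A`, and `h` says that `(x, y)` lies in the range. -/
theorem block_pseudoinverse {A J ω x y : ℝ} (hA : A ≠ 0) (hd : A ^ 2 - J ^ 2 - ω ^ 2 = 0)
    (h : (A - J) * x = ω * y) :
    (J + A) * ((A + J) / (2 * A) ^ 2 * x + ω / (2 * A) ^ 2 * y)
      + ω * ((A - J) / (2 * A) ^ 2 * y + ω / (2 * A) ^ 2 * x) = x := by
  field_simp
  linear_combination (-2 * A) * h - x * hd

/-- A bounded inverse of `L(ω₀)` on the even families annihilated by `kernelFunctional`. There is
no gain of derivatives. -/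
theorem exists_partialInverse {q : ℤ} (hq : q ≠ 0) {k₀ : ℕ} (hk₀ : 0 < k₀) :
    ∃ K : Coeffs →L[ℝ] Coeffs,
      (∀ f, flipCoeffs f = f → flipCoeffs (K f) = K f) ∧
      (∀ f, kernelFunctional q k₀ (K f) = 0) ∧
      ∀ f, flipCoeffs f = f → kernelFunctional q k₀ f = 0 → ∀ p : ℤ × ℤ,
        ((p.1 : ℝ) / q + (p.2 : ℝ) ^ 2 + omega0 q k₀) * K f p + omega0 q k₀ * K f (-p) = f p := by
  have h1 : (q : ℝ) ≠ 0 := by exact_mod_cast hq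
  have h2 : (k₀ : ℝ) ≠ 0 := by positivity
  obtain ⟨⟨C, hC⟩, ⟨C', hC'⟩⟩ := resolvent_bounded hq hk₀
  set K : Coeffs →L[ℝ] Coeffs := reindexMul (Equiv.refl _) (resolventDiag q k₀) C hC
    + reindexMul (Equiv.neg _) (resolventOff q k₀) C' hC' with hK
  have hKa : ∀ f p, K f p = resolventDiag q k₀ p * f p + resolventOff q k₀ p * f (-p) := by
    intro f p
    have : K f p = reindexMul (Equiv.refl _) (resolventDiag q k₀) C hC f p
      + reindexMul (Equiv.neg _) (resolventOff q k₀) C' hC' f p := rfl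
    rw [this, reindexMul_apply, reindexMul_apply]
    rfl
  refine ⟨K, fun f hf => ?_, fun f => ?_, fun f hf hP p => ?_⟩
  · ext p
    have e1 : resolventDiag q k₀ (p.1, -p.2) = resolventDiag q k₀ p := by
      simp [resolventDiag, resonance_flip]
    have e2 : resolventOff q k₀ (p.1, -p.2) = resolventOff q k₀ p := by
      simp [resolventOff, resonance_flip]
    have e3 : f (-((p.1, -p.2) : ℤ × ℤ)) = f (-p) := apply_flip_of_even hf (-p.1) (-p.2)
    rw [flipCoeffs_apply, hKa, hKa, e1, e2, e3, apply_flip_of_even hf]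
  -- At the resonant pair `K f` lies in the range of the symmetric singular block, which is
  -- orthogonal to the kernel vector that defines the functional.
  · have hr : resonance q k₀ (j0 q k₀, (k₀ : ℤ)) = 0 :=
      resonance_eq_zero_of_mem (by simp [resonantSet])
    have hr' : resonance q k₀ (-j0 q k₀, -(k₀ : ℤ)) = 0 :=
      resonance_eq_zero_of_mem (by simp [resonantSet])
    have hs := symbol_sub_eq hq hk₀
    have ha := symbol_add_eq hq hk₀
    have hω := omega0_eq hq hk₀
    rw [kernelFunctional_apply, hKa, hKa]
    simp only [resolventDiag, resolventOff, hr, hr', if_true, Prod.neg_mk, neg_neg]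
    push_cast
    rw [neg_div, ← sub_eq_add_neg, neg_sq, hs, ha]
    generalize f (j0 q k₀, (k₀ : ℤ)) = x
    generalize f (-j0 q k₀, -(k₀ : ℤ)) = y
    generalize hT : (2 * ((k₀ : ℝ) ^ 2 + omega0 q k₀)) ^ 2 = T
    rw [hω]
    ring
  · set ω := omega0 q k₀ with hωdef
    by_cases hr : resonance q k₀ p = 0
    · have hr' : resonance q k₀ (-p) = 0 := by rw [resonance_neg, hr]
      have hp : p ∈ resonantSet q k₀ := by
        rcases resonance_eq_zero_or_le hq hk₀ p with h | h
        · exact h.2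
        · rw [hr, abs_zero, mul_zero] at h
          have := sq_nonneg p.2
          have := abs_nonneg p.1
          omega
      have hdet := det_eq_resonance hq hk₀ p
      rw [hr, Int.cast_zero, zero_div, ← hωdef] at hdet
      rw [hKa, hKa]
      simp only [resolventDiag, resolventOff, hr, hr', if_true, neg_neg, Prod.fst_neg,
        Prod.snd_neg]
      push_cast
      rw [neg_sq, ← hωdef]
      -- The solvability condition is automatic at the origin, where `p = -p`: real coefficients
      -- exclude the imaginary constants. At the other four frequencies it is `kernelFunctional q k₀
      -- f = 0`, up to a factor and evenness.
      have hA : (p.2 : ℝ) ^ 2 + ω ≠ 0 ∧ ((p.2 : ℝ) ^ 2 + ω - p.1 / q) * f p = ω * f (-p) := by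
        have hs := symbol_sub_eq hq hk₀
        have ha := symbol_add_eq hq hk₀
        have hω := omega0_eq hq hk₀
        have hpos := (sq_add_omega0_pos hq hk₀).ne'
        rw [kernelFunctional_apply] at hP
        have hx := apply_flip_of_even hf (j0 q k₀) k₀
        have hy := apply_flip_of_even hf (-j0 q k₀) k₀
        simp only [resonantSet, Finset.mem_insert, Finset.mem_singleton] at hp
        rw [hy] at hP
        rcases hp with rfl | rfl | rfl | rfl | rfl <;>
          simp only [Int.cast_zero, Int.cast_neg, Int.cast_natCast, Prod.neg_mk, neg_neg, neg_zero,
            neg_div, sub_neg_eq_add, neg_sq, hx, hy, hωdef]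
        · refine ⟨by simpa using omega0_ne_zero hq hk₀, by simp⟩
        all_goals
          refine ⟨hpos, ?_⟩
          first | rw [hs] | rw [ha]
          rw [hω]
          field_simp
          first
            | linear_combination hP
            | linear_combination (2 * (k₀ : ℝ) ^ 2 * q - 1) * hP
      obtain ⟨hA0, hA1⟩ := hA
      have := block_pseudoinverse hA0 hdet hA1
      linear_combination this
    · have hr' : resonance q k₀ (-p) ≠ 0 := by rwa [resonance_neg]
      have hdet := det_eq_resonance hq hk₀ p
      have hd : ((p.2 : ℝ) ^ 2 + ω) ^ 2 - ((p.1 : ℝ) / q) ^ 2 - ω ^ 2 ≠ 0 := by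
        rw [hdet]
        exact div_ne_zero (by exact_mod_cast hr) (by positivity)
      rw [hKa, hKa]
      simp only [resolventDiag, resolventOff, hr, hr', if_false, neg_neg, Prod.fst_neg,
        Prod.snd_neg]
      push_cast
      rw [neg_sq, neg_div (q : ℝ), neg_sq, ← hωdef]
      have := block_inverse hd (f p) (f (-p))
      linear_combination this

/-! ### The coefficients of the profile -/

/-- The weighted Fourier coefficients of `profile q k₀`. -/
def profileCoeffs (r : ℕ) (q : ℤ) (k₀ : ℕ) : Coeffs :=
  (weight r (j0 q k₀, (k₀ : ℤ)) / 2) •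
    ((1 / (2 * (k₀ : ℝ) ^ 2 * q)) •
        (Coeffs.single (j0 q k₀, (k₀ : ℤ)) + Coeffs.single (j0 q k₀, -(k₀ : ℤ)))
      + (1 - 1 / (2 * (k₀ : ℝ) ^ 2 * q)) •
        (Coeffs.single (-j0 q k₀, (k₀ : ℤ)) + Coeffs.single (-j0 q k₀, -(k₀ : ℤ))))

theorem profileCoeffs_apply (r : ℕ) (q : ℤ) (k₀ : ℕ) (p : ℤ × ℤ) : profileCoeffs r q k₀ p
    = (weight r (j0 q k₀, (k₀ : ℤ)) / 2) *
    ((1 / (2 * (k₀ : ℝ) ^ 2 * q)) *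
        (Coeffs.single (j0 q k₀, (k₀ : ℤ)) p + Coeffs.single (j0 q k₀, -(k₀ : ℤ)) p)
      + (1 - 1 / (2 * (k₀ : ℝ) ^ 2 * q)) *
        (Coeffs.single (-j0 q k₀, (k₀ : ℤ)) p + Coeffs.single (-j0 q k₀, -(k₀ : ℤ)) p)) :=
  rfl

theorem flipCoeffs_profileCoeffs (r : ℕ) (q : ℤ) (k₀ : ℕ) :
    flipCoeffs (profileCoeffs r q k₀) = profileCoeffs r q k₀ := by
  simp only [profileCoeffs, map_smul, map_add, flipCoeffs_single, neg_neg]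
  rw [add_comm (Coeffs.single (j0 q k₀, -(k₀ : ℤ))), add_comm (Coeffs.single (-j0 q k₀, -(k₀ : ℤ)))]

theorem mul_single_apply (X : ℤ × ℤ → ℝ) (a p : ℤ × ℤ) :
    X p * Coeffs.single a p = X a * Coeffs.single a p := by
  rw [Coeffs.single_apply]
  split_ifs with h
  · rw [h]
  · simp

theorem single_neg_apply (a p : ℤ × ℤ) : Coeffs.single a (-p) = Coeffs.single (-a) p := by
  rw [Coeffs.single_apply, Coeffs.single_apply]
  simp only [neg_eq_iff_eq_neg]

/-- The profile lies in the kernel of `L(ω₀)`. -/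
theorem symbol_profileCoeffs {q : ℤ} (hq : q ≠ 0) {k₀ : ℕ} (hk₀ : 0 < k₀) (r : ℕ) (p : ℤ × ℤ) :
    ((p.1 : ℝ) / q + (p.2 : ℝ) ^ 2 + omega0 q k₀) * profileCoeffs r q k₀ p
      + omega0 q k₀ * profileCoeffs r q k₀ (-p) = 0 := by
  have h1 : (q : ℝ) ≠ 0 := by exact_mod_cast hq
  have h2 : (k₀ : ℝ) ≠ 0 := by positivity
  set X : ℤ × ℤ → ℝ := fun p => (p.1 : ℝ) / q + (p.2 : ℝ) ^ 2 + omega0 q k₀ with hX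
  -- The profile lives on four frequencies, so the symbol may be replaced by its value at each of
  -- them.
  have e1 := mul_single_apply X (j0 q k₀, (k₀ : ℤ)) p
  have e2 := mul_single_apply X (j0 q k₀, -(k₀ : ℤ)) p
  have e3 := mul_single_apply X (-j0 q k₀, (k₀ : ℤ)) p
  have e4 := mul_single_apply X (-j0 q k₀, -(k₀ : ℤ)) p
  have x1 : X (j0 q k₀, (k₀ : ℤ))
      = (2 * (k₀ : ℝ) ^ 2 * q - 1) ^ 2 / (2 * (k₀ : ℝ) ^ 2 * (q : ℝ) ^ 2) := by
    rw [← symbol_add_eq hq hk₀, hX]; push_cast; ring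
  have x2 : X (j0 q k₀, -(k₀ : ℤ))
      = (2 * (k₀ : ℝ) ^ 2 * q - 1) ^ 2 / (2 * (k₀ : ℝ) ^ 2 * (q : ℝ) ^ 2) := by
    rw [← symbol_add_eq hq hk₀, hX]; push_cast; ring
  have x3 : X (-j0 q k₀, (k₀ : ℤ)) = 1 / (2 * (k₀ : ℝ) ^ 2 * (q : ℝ) ^ 2) := by
    rw [← symbol_sub_eq hq hk₀, hX]; push_cast; ring
  have x4 : X (-j0 q k₀, -(k₀ : ℤ)) = 1 / (2 * (k₀ : ℝ) ^ 2 * (q : ℝ) ^ 2) := by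
    rw [← symbol_sub_eq hq hk₀, hX]; push_cast; ring
  rw [x1] at e1
  rw [x2] at e2
  rw [x3] at e3
  rw [x4] at e4
  change X p * _ + _ = 0
  rw [profileCoeffs_apply, profileCoeffs_apply]
  simp only [single_neg_apply, Prod.neg_mk, neg_neg]
  rw [omega0_eq hq hk₀]
  generalize X p = x at *
  generalize Coeffs.single (j0 q k₀, (k₀ : ℤ)) p = s1 at *
  generalize Coeffs.single (j0 q k₀, -(k₀ : ℤ)) p = s2 at *
  generalize Coeffs.single (-j0 q k₀, (k₀ : ℤ)) p = s3 at *
  generalize Coeffs.single (-j0 q k₀, -(k₀ : ℤ)) p = s4 at *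
  generalize weight r (j0 q k₀, (k₀ : ℤ)) = w at *
  have hN : (2 * (k₀ : ℝ) ^ 2 * q) ≠ 0 := by positivity
  have key : x * (w / 2 * (1 / (2 * (k₀ : ℝ) ^ 2 * q) * (s1 + s2)
        + (1 - 1 / (2 * (k₀ : ℝ) ^ 2 * q)) * (s3 + s4)))
      = w / 2 * (1 / (2 * (k₀ : ℝ) ^ 2 * q) * (x * s1 + x * s2)
        + (1 - 1 / (2 * (k₀ : ℝ) ^ 2 * q)) * (x * s3 + x * s4)) := by ring
  rw [key, e1, e2, e3, e4]
  field_simp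
  ring

theorem synth_profileCoeffs {q : ℤ} (hq : q ≠ 0) {k₀ : ℕ} (hk₀ : 0 < k₀) (r : ℕ) (t s : ℝ) :
    synth r t s (profileCoeffs r q k₀) = profile q k₀ t s := by
  have h1 : (q : ℂ) ≠ 0 := by exact_mod_cast hq
  have h2 : (k₀ : ℂ) ≠ 0 := by exact_mod_cast hk₀.ne'
  have hw := weight_pos r (j0 q k₀, (k₀ : ℤ))
  have w2 : weight r (j0 q k₀, -(k₀ : ℤ)) = weight r (j0 q k₀, (k₀ : ℤ)) := by simp [weight]
  have w3 : weight r (-j0 q k₀, (k₀ : ℤ)) = weight r (j0 q k₀, (k₀ : ℤ)) := by simp [weight]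
  have w4 : weight r (-j0 q k₀, -(k₀ : ℤ)) = weight r (j0 q k₀, (k₀ : ℤ)) := by simp [weight]
  have hm : ∀ a b : ℤ, mode (a, b) t s = (Complex.cos (a * t) + Complex.sin (a * t) * Complex.I)
      * (Complex.cos (b * s) + Complex.sin (b * s) * Complex.I) := fun a b => by
    rw [mode, ← Complex.exp_mul_I, ← Complex.exp_mul_I, ← Complex.exp_add]
    ring_nf
  simp only [profileCoeffs, map_smul, map_add, synth_single, w2, w3, w4, hm, profile,
    Complex.real_smul]
  have hw' : (weight r (j0 q k₀, (k₀ : ℤ)) : ℂ) ≠ 0 := by exact_mod_cast hw.ne'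
  push_cast
  simp only [neg_mul, Complex.cos_neg, Complex.sin_neg]
  field_simp
  ring

/-- If `j₀ = 0`, the four frequencies of the profile collapse to two; this case needs separate
computations. -/
theorem j0_ne_zero_or (q : ℤ) (k₀ : ℕ) :
    j0 q k₀ ≠ 0 ∨ j0 q k₀ = 0 ∧ (k₀ : ℝ) ^ 2 * q = 1 := by
  rcases eq_or_ne (j0 q k₀) 0 with h | h
  · right
    refine ⟨h, ?_⟩
    have : (q : ℤ) * (k₀ : ℤ) ^ 2 = 1 := by unfold j0 at h; linarith
    have h3 : (q : ℝ) * (k₀ : ℝ) ^ 2 = 1 := by exact_mod_cast this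
    linarith
  · exact Or.inl h

/-- The functional thus recovers `b` along the branch, which gives injectivity and, when `j₀ ≠ 0`,
time dependence. -/
theorem kernelFunctional_profileCoeffs_ne_zero {q : ℤ} (hq : q ≠ 0) {k₀ : ℕ} (hk₀ : 0 < k₀)
    (r : ℕ) : kernelFunctional q k₀ (profileCoeffs r q k₀) ≠ 0 := by
  have h1 : (q : ℝ) ≠ 0 := by exact_mod_cast hq
  have h2 : (k₀ : ℝ) ≠ 0 := by positivity
  have hw := weight_pos r (j0 q k₀, (k₀ : ℤ))
  have hk : (k₀ : ℤ) ≠ 0 := by exact_mod_cast hk₀.ne'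
  have hk1 : ¬ ((k₀ : ℤ) = -k₀) := by omega
  have hk2 : ¬ (-(k₀ : ℤ) = k₀) := by omega
  rw [kernelFunctional_apply, profileCoeffs_apply, profileCoeffs_apply]
  simp only [Coeffs.single_apply, Prod.mk.injEq]
  rcases j0_ne_zero_or q k₀ with hj | ⟨hj, hN⟩
  · have hj1 : ¬ (j0 q k₀ = -j0 q k₀) := by omega
    have hj2 : ¬ (-j0 q k₀ = j0 q k₀) := by omega
    simp only [hk1, hk2, hj1, hj2, and_true, and_false, if_true, if_false]
    have : weight r (j0 q k₀, (k₀ : ℤ)) / 2 * (1 / (2 * (k₀ : ℝ) ^ 2 * q) * (1 + 0)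
          + (1 - 1 / (2 * (k₀ : ℝ) ^ 2 * q)) * (0 + 0))
        + (2 * (k₀ : ℝ) ^ 2 * q - 1) * (weight r (j0 q k₀, (k₀ : ℤ)) / 2
          * (1 / (2 * (k₀ : ℝ) ^ 2 * q) * (0 + 0)
          + (1 - 1 / (2 * (k₀ : ℝ) ^ 2 * q)) * (0 + 1)))
        = weight r (j0 q k₀, (k₀ : ℤ)) / (4 * (k₀ : ℝ) ^ 2 * q)
          * (1 + (2 * (k₀ : ℝ) ^ 2 * q - 1) ^ 2) := by
      field_simp
      ring
    rw [this]
    have h3 : 1 + (2 * (k₀ : ℝ) ^ 2 * q - 1) ^ 2 ≠ 0 := by positivity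
    have h4 : weight r (j0 q k₀, (k₀ : ℤ)) ≠ 0 := hw.ne'
    positivity
  · have hN' : 2 * (k₀ : ℝ) ^ 2 * q = 2 := by linarith
    simp only [hk1, hk2, hj, neg_zero, and_true, and_false, if_true, if_false, hN']
    rw [hj] at hw
    norm_num
    exact hw.ne'

/-- The crossing condition: `u + ū` is the derivative of `L(ω) u` in `ω`. The value is a nonzero
multiple of `k₀² q`. -/
theorem kernelFunctional_transversal {q : ℤ} (hq : q ≠ 0) {k₀ : ℕ} (hk₀ : 0 < k₀)
    (r : ℕ) : kernelFunctional q k₀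
      (profileCoeffs r q k₀ + conjCoeffs (profileCoeffs r q k₀)) ≠ 0 := by
  have h1 : (q : ℝ) ≠ 0 := by exact_mod_cast hq
  have h2 : (k₀ : ℝ) ≠ 0 := by positivity
  have hw := weight_pos r (j0 q k₀, (k₀ : ℤ))
  have hk : (k₀ : ℤ) ≠ 0 := by exact_mod_cast hk₀.ne'
  have hk1 : ¬ ((k₀ : ℤ) = -k₀) := by omega
  have hk2 : ¬ (-(k₀ : ℤ) = k₀) := by omega
  rw [map_add, kernelFunctional_apply, kernelFunctional_apply, conjCoeffs_apply, conjCoeffs_apply]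
  simp only [Prod.neg_mk, neg_neg]
  rw [profileCoeffs_apply, profileCoeffs_apply]
  simp only [Coeffs.single_apply, Prod.mk.injEq]
  rcases j0_ne_zero_or q k₀ with hj | ⟨hj, hN⟩
  · have hj1 : ¬ (j0 q k₀ = -j0 q k₀) := by omega
    have hj2 : ¬ (-j0 q k₀ = j0 q k₀) := by omega
    simp only [hk1, hk2, hj1, hj2, and_true, and_false, if_true, if_false]
    intro h
    have : weight r (j0 q k₀, (k₀ : ℤ)) * ((k₀ : ℝ) ^ 2 * q) = 0 := by
      rw [← h]
      field_simp
      ring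
    have h4 : weight r (j0 q k₀, (k₀ : ℤ)) ≠ 0 := hw.ne'
    have h5 : weight r (j0 q k₀, (k₀ : ℤ)) * ((k₀ : ℝ) ^ 2 * q) ≠ 0 := by positivity
    exact h5 this
  · have hN' : 2 * (k₀ : ℝ) ^ 2 * q = 2 := by linarith
    simp only [hk1, hk2, hj, neg_zero, and_true, and_false, if_true, if_false, hN']
    rw [hj] at hw
    norm_num
    linarith

/-- The square of the conjugate profile has no component along the kernel. -/
theorem kernelFunctional_convolution_profile {k₀ : ℕ} (hk₀ : 0 < k₀) (r : ℕ) (q : ℤ) :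
    kernelFunctional q k₀ (convolution r (conjCoeffs (profileCoeffs r q k₀))
      (conjCoeffs (profileCoeffs r q k₀))) = 0 := by
  have hk : (k₀ : ℤ) ≠ 0 := by exact_mod_cast hk₀.ne'
  -- The product of two modes with spatial frequencies `±k₀` has spatial frequency `0` or `±2 k₀`,
  -- never `±k₀`.
  have key : ∀ a b ε δ : ℤ, (ε = k₀ ∨ ε = -k₀) → (δ = k₀ ∨ δ = -k₀) →
      kernelFunctional q k₀ (convolution r (Coeffs.single (a, ε)) (Coeffs.single (b, δ))) = 0 := by
    intro a b ε δ hε hδ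
    have n1 : ¬ ((k₀ : ℤ) = ε + δ) := by omega
    have n2 : ¬ (-(k₀ : ℤ) = ε + δ) := by omega
    rw [convolution_single, map_smul, kernelFunctional_apply, Coeffs.single_apply,
      Coeffs.single_apply]
    simp [n1, n2]
  simp only [profileCoeffs, map_smul, map_add, conjCoeffs_single, Prod.neg_mk, neg_neg,
    add_apply, smul_apply]
  rw [key, key, key, key, key, key, key, key, key, key, key, key, key, key, key, key] <;> simp

/-! ### The bifurcating curve -/

/-- The projection to families that are even in `k`. -/
def evenPart : Coeffs →L[ℝ] Coeffs :=
  (1 / 2 : ℝ) • (ContinuousLinearMap.id ℝ Coeffs + flipCoeffs)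

theorem flipCoeffs_flipCoeffs (f : Coeffs) : flipCoeffs (flipCoeffs f) = f := by
  ext p
  simp [flipCoeffs_apply]

theorem evenPart_of_even {f : Coeffs} (hf : flipCoeffs f = f) : evenPart f = f := by
  have : evenPart f = (1 / 2 : ℝ) • (f + flipCoeffs f) := rfl
  rw [this, hf, ← two_smul ℝ f, smul_smul]
  norm_num

theorem flipCoeffs_evenPart (f : Coeffs) : flipCoeffs (evenPart f) = evenPart f := by
  have : evenPart f = (1 / 2 : ℝ) • (f + flipCoeffs f) := rfl
  rw [this, map_smul, map_add, flipCoeffs_flipCoeffs, add_comm]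

theorem flipCoeffs_conjCoeffs (f : Coeffs) :
    flipCoeffs (conjCoeffs f) = conjCoeffs (flipCoeffs f) := by
  ext p
  rw [flipCoeffs_apply, conjCoeffs_apply, conjCoeffs_apply, flipCoeffs_apply]
  rfl

theorem norm_reindexMul_le (e : ℤ × ℤ ≃ ℤ × ℤ) (m : ℤ × ℤ → ℝ) (C : ℝ) (hm : ∀ p, |m p| ≤ C) :
    ‖reindexMul e m C hm‖ ≤ C :=
  norm_sumMap_le _

theorem norm_conjCoeffs_le (f : Coeffs) : ‖conjCoeffs f‖ ≤ ‖f‖ := by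
  have h : ‖conjCoeffs‖ ≤ 1 := norm_reindexMul_le _ _ _ _
  simpa using conjCoeffs.le_of_opNorm_le h f

theorem norm_convolution_le (r : ℕ) (f g : Coeffs) : ‖convolution r f g‖ ≤ ‖f‖ * ‖g‖ := by
  have h : ‖convolution r‖ ≤ 1 := norm_sumMap_le _
  calc _ ≤ ‖convolution r‖ * ‖f‖ * ‖g‖ := (convolution r).le_opNorm₂ f g
    _ ≤ 1 * ‖f‖ * ‖g‖ := by gcongr
    _ = _ := by ring

/-- The solution of `y + b z y = z²` inherits the evenness of `z` when `b z` is small. -/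
theorem flipCoeffs_eq_of_quotient_eq {r : ℕ} {b : ℝ} {z y : Coeffs} (hz : flipCoeffs z = z)
    (hb : |b| * ‖z‖ < 1) (hy : y + b • convolution r z y = convolution r z z) :
    flipCoeffs y = y := by
  have h1 : flipCoeffs y + b • convolution r z (flipCoeffs y) = convolution r z z := by
    have := congrArg flipCoeffs hy
    simpa only [map_add, map_smul, flipCoeffs_convolution, hz] using this
  -- The reflected family solves the same linear equation, so the difference is a fixed point of a
  -- strict contraction.
  have h2 : flipCoeffs y - y = - (b • convolution r z (flipCoeffs y - y)) := by
    rw [map_sub, smul_sub, eq_neg_iff_add_eq_zero, ← sub_eq_zero.2 (h1.trans hy.symm)]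
    abel
  have h3 : ‖flipCoeffs y - y‖ ≤ |b| * ‖z‖ * ‖flipCoeffs y - y‖ := by
    conv_lhs => rw [h2, norm_neg, norm_smul, Real.norm_eq_abs]
    rw [mul_assoc]
    exact mul_le_mul_of_nonneg_left (norm_convolution_le r _ _) (abs_nonneg b)
  have h4 : ‖flipCoeffs y - y‖ = 0 := by
    by_contra h
    have h5 : 0 < ‖flipCoeffs y - y‖ := lt_of_le_of_ne (norm_nonneg _) (Ne.symm h)
    nlinarith
  exact sub_eq_zero.1 (norm_eq_zero.1 h4)

theorem linOp_add_omega (q : ℤ) (ω μ : ℝ) (u : ℝ → ℝ → ℂ) (t s : ℝ) :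
    linOp q (ω + μ) u t s = linOp q ω u t s + μ * (u t s + conj (u t s)) := by
  simp only [linOp]
  push_cast
  ring

/-- The equation for the coefficients implies the equation `L(ω)u + g(u) = 0`. -/
theorem equation_of_coeffs {r : ℕ} (hr : 2 ≤ r) {q : ℤ} {ω₀ μ b : ℝ} {g y : Coeffs}
    (hsmall : ∀ t s, ‖synth r t s (b • g)‖ < 1)
    (hy : y + b • convolution r (conjCoeffs g) y
      = convolution r (conjCoeffs g) (conjCoeffs g))
    (hg : ∀ p : ℤ × ℤ, ((p.1 : ℝ) / q + (p.2 : ℝ) ^ 2 + ω₀) * g p + ω₀ * g (-p)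
      = (-(μ • (g + conjCoeffs g) - ((ω₀ + μ) * b) • y) : Coeffs) p) (t s : ℝ) :
    linOp q (ω₀ + μ) (fun t s => synth r t s (b • g)) t s
      + nonlin (ω₀ + μ) (synth r t s (b • g)) = 0 := by
  have hlin := linOp_synth hr (q := q) (ω := ω₀) (f := b • g)
    (h := b • (-(μ • (g + conjCoeffs g) - ((ω₀ + μ) * b) • y))) (fun p => by
      have e1 : (b • g) p = b * g p := rfl
      have e2 : (b • g) (-p) = b * g (-p) := rfl
      have e3 : (b • (-(μ • (g + conjCoeffs g) - ((ω₀ + μ) * b) • y))) p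
        = b * (-(μ • (g + conjCoeffs g) - ((ω₀ + μ) * b) • y) : Coeffs) p := rfl
      rw [e1, e2, e3, ← hg p]
      ring) t s
  rw [linOp_add_omega, hlin]
  have hz := congrArg (synth r t s) hy
  simp only [map_add, map_smul, synth_convolution, synth_conjCoeffs, Complex.real_smul] at hz
  have hs := hsmall t s
  simp only [map_smul, map_neg, map_sub, map_add, synth_conjCoeffs, Complex.real_smul, nonlin,
    map_mul, Complex.conj_ofReal] at hs ⊢
  set x := synth r t s g
  set Y := synth r t s y
  -- Smallness of `u` makes the denominator invertible, so pointwise `y` is the quotient `x̄² / (1 +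
  -- b x̄)`.
  have hne : 1 + (b : ℂ) * conj x ≠ 0 := by
    intro h0
    have h1 : (b : ℂ) * conj x = -1 := by linear_combination h0
    have h2 : ‖(b : ℂ) * conj x‖ = ‖(b : ℂ) * x‖ := by rw [norm_mul, norm_mul, RCLike.norm_conj]
    rw [h1, norm_neg, norm_one] at h2
    linarith
  push_cast
  field_simp
  linear_combination (b : ℂ) ^ 2 * ((ω₀ : ℂ) + μ) * hz

/-- The curve of solutions bifurcating from `(0, ω₀)`, in terms of coefficients. -/
theorem exists_coeff_curve {q : ℤ} (hq : q ≠ 0) {k₀ : ℕ} (hk₀ : 0 < k₀) {r : ℕ} (hr : 2 ≤ r) :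
    ∃ b₀ : ℝ, 0 < b₀ ∧ ∃ C : ℝ, 0 ≤ C ∧ ∃ (f : ℝ → Coeffs) (ω : ℝ → ℝ),
      f 0 = 0 ∧ ω 0 = omega0 q k₀ ∧ ContinuousOn ω (Set.Icc 0 b₀) ∧
      ContinuousOn f (Set.Icc 0 b₀) ∧
      ∀ b ∈ Set.Icc 0 b₀,
        flipCoeffs (f b) = f b ∧
        kernelFunctional q k₀ (f b) = b * kernelFunctional q k₀ (profileCoeffs r q k₀) ∧
        ‖f b‖ < 1 ∧
        (∀ t s, linOp q (ω b) (fun t s => synth r t s (f b)) t s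
          + nonlin (ω b) (synth r t s (f b)) = 0) ∧
        ‖f b - b • profileCoeffs r q k₀‖ ≤ C * b ^ 2 ∧
        |ω b - omega0 q k₀| ≤ C * b ^ 2 ∧ |ω b - omega0 q k₀| < |omega0 q k₀| := by
  obtain ⟨K, hKeven, hKP, hKinv⟩ := exists_partialInverse hq hk₀
  set φ := profileCoeffs r q k₀ with hφ
  set P := kernelFunctional q k₀ with hPdef
  have hφe : flipCoeffs φ = φ := flipCoeffs_profileCoeffs r q k₀
  have hRφe : flipCoeffs (conjCoeffs φ) = conjCoeffs φ := by rw [flipCoeffs_conjCoeffs, hφe]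
  -- The system is solved on all families, with `K` and `P` precomposed with `evenPart`. Evenness is
  -- recovered afterwards: `v` is even as a value of `K`, then `y` is even by uniqueness for small
  -- `b`, then so is the forcing, and the projection disappears.
  obtain ⟨b₁, hb₁, C, hC, v, μ, y, hv0, hμ0, hvc, hμc, hsol⟩ :=
    exists_branch (K ∘L evenPart) conjCoeffs (P ∘L evenPart) (convolution r) φ (omega0 q k₀)
      (by
        rw [ContinuousLinearMap.comp_apply, evenPart_of_even (by rw [map_add, hφe, hRφe])]
        exact kernelFunctional_transversal hq hk₀ r)
      (by
        rw [ContinuousLinearMap.comp_apply,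
          evenPart_of_even (by rw [flipCoeffs_convolution, hRφe])]
        exact kernelFunctional_convolution_profile hk₀ r q)
  have hω : 0 < |omega0 q k₀| := abs_pos.2 (omega0_ne_zero hq hk₀)
  -- The third bound gives `‖b (φ + v)‖ < 1`. The last one, together with `b² ≤ b`, gives `|μ| <
  -- |ω₀|`, so that `ω` keeps the sign of `ω₀`.
  set b₀ := min b₁ (min 1 (min (1 / (‖φ‖ + C * b₁ + 1)) (|omega0 q k₀| / (C + 1)))) with hb₀
  have hb0pos : 0 < b₀ := by positivity
  have hle1 : b₀ ≤ b₁ := min_le_left _ _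
  have hle2 : b₀ ≤ 1 := (min_le_right _ _).trans (min_le_left _ _)
  have hle3 : b₀ ≤ 1 / (‖φ‖ + C * b₁ + 1) :=
    (min_le_right _ _).trans ((min_le_right _ _).trans (min_le_left _ _))
  have hle4 : b₀ ≤ |omega0 q k₀| / (C + 1) :=
    (min_le_right _ _).trans ((min_le_right _ _).trans (min_le_right _ _))
  have hsub : Set.Icc 0 b₀ ⊆ Set.Icc 0 b₁ := Set.Icc_subset_Icc_right hle1
  refine ⟨b₀, hb0pos, C, hC, fun b => b • (φ + v b), fun b => omega0 q k₀ + μ b, by simp,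
    by simp [hμ0], continuousOn_const.add (hμc.mono hsub),
    continuousOn_id.smul (continuousOn_const.add (hvc.mono hsub)), fun b hb => ?_⟩
  obtain ⟨hy, hv, hPW, hvn, hμn⟩ := hsol b (hsub hb)
  rw [ContinuousLinearMap.comp_apply] at hv hPW
  have hb0 : 0 ≤ b := hb.1
  have hve : flipCoeffs (v b) = v b := by
    rw [hv, map_neg, hKeven _ (flipCoeffs_evenPart _)]
  have hge : flipCoeffs (φ + v b) = φ + v b := by rw [map_add, hφe, hve]
  have hze : flipCoeffs (conjCoeffs (φ + v b)) = conjCoeffs (φ + v b) := by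
    rw [flipCoeffs_conjCoeffs, hge]
  have hgn : ‖φ + v b‖ ≤ ‖φ‖ + C * b₁ :=
    (norm_add_le _ _).trans (by gcongr; exact hvn.trans (by gcongr; exact (hsub hb).2))
  have hsmall : b * ‖φ + v b‖ < 1 := by
    have hpos : 0 < ‖φ‖ + C * b₁ + 1 := by positivity
    calc b * ‖φ + v b‖ ≤ 1 / (‖φ‖ + C * b₁ + 1) * (‖φ‖ + C * b₁) := by
          gcongr; exact hb.2.trans hle3
      _ < 1 := by rw [one_div, inv_mul_lt_one₀ hpos]; linarith
  have hye : flipCoeffs (y b) = y b := by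
    refine flipCoeffs_eq_of_quotient_eq hze ?_ hy
    rw [abs_of_nonneg hb0]
    exact (mul_le_mul_of_nonneg_left (norm_conjCoeffs_le _) hb0).trans_lt hsmall
  have hWe : flipCoeffs (forcing conjCoeffs φ (omega0 q k₀) b (v b) (μ b) (y b))
      = forcing conjCoeffs φ (omega0 q k₀) b (v b) (μ b) (y b) := by
    unfold forcing
    rw [map_sub, map_smul, map_smul, map_add _ (φ + v b), hge, hze, hye]
  rw [evenPart_of_even hWe] at hv hPW
  have hnorm : ‖b • (φ + v b)‖ < 1 := by
    rwa [norm_smul, Real.norm_of_nonneg hb0]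
  have hμlt : |μ b| < |omega0 q k₀| := by
    have h1 : b ^ 2 ≤ b := by
      have : b ≤ 1 := hb.2.trans hle2
      nlinarith
    calc |μ b| ≤ C * b ^ 2 := hμn
      _ ≤ C * (|omega0 q k₀| / (C + 1)) := by
        gcongr
        exact h1.trans (hb.2.trans hle4)
      _ < |omega0 q k₀| := by
        rw [mul_div_assoc', div_lt_iff₀ (by positivity)]
        nlinarith
  refine ⟨by rw [map_smul, hge], ?_, hnorm, ?_, ?_, ?_, ?_⟩
  · rw [map_smul, map_add, hv, map_neg, hKP, neg_zero, add_zero, smul_eq_mul]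
  · refine equation_of_coeffs hr (fun t s => (norm_synth_le r t s _).trans_lt hnorm) hy fun p => ?_
    have h1 := symbol_profileCoeffs hq hk₀ r p
    have h2 := hKinv _ hWe hPW p
    have e1 : ∀ n, (φ + v b) n = φ n
        - K (forcing conjCoeffs φ (omega0 q k₀) b (v b) (μ b) (y b)) n := by
      intro n
      have : (φ + v b) n = φ n + v b n := rfl
      rw [this, sub_eq_add_neg]
      congr 1
      exact congrArg (fun f : Coeffs => f n) hv
    have e2 : (-(μ b • (φ + v b + conjCoeffs (φ + v b)) - ((omega0 q k₀ + μ b) * b) • y b)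
        : Coeffs) p = - forcing conjCoeffs φ (omega0 q k₀) b (v b) (μ b) (y b) p := rfl
    rw [e1, e1, e2]
    linear_combination h1 - h2
  · change ‖b • (φ + v b) - b • φ‖ ≤ _
    rw [smul_add, add_sub_cancel_left, norm_smul, Real.norm_of_nonneg hb0]
    calc b * ‖v b‖ ≤ b * (C * b) := by gcongr
      _ = C * b ^ 2 := by ring
  · simpa using hμn
  · simpa using hμlt

/-! ### Homographic solutions of the filament system -/

theorem IsCentralConfiguration.ne_zero {n : ℕ} {κ : ℝ} {a : Fin (n + 1) → ℂ}
    (ha : IsCentralConfiguration n κ a) {j : Fin (n + 1)} (hj : j ≠ 0) : a j ≠ 0 :=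
  fun h => hj (ha.injective (h.trans ha.center.symm))

theorem one_add_ne_zero_of_norm_lt_one {z : ℂ} (hz : ‖z‖ < 1) : 1 + z ≠ 0 := by
  intro h
  have : z = -1 := by linear_combination h
  rw [this, norm_neg, norm_one] at hz
  exact lt_irrefl _ hz

/-- Every filament is `a_j w`, and `z ↦ z / |z|²` is multiplicative, so the interaction equals `-a_j
w / |w|²`. Since `ω = -α⁻²`, the equation for `u` is exactly `∂ₜ w = i (∂ₛₛ w - w / |w|²)`. -/
theorem isFilamentSolution_homographic {q : ℤ} (hq : q ≠ 0) {ω α : ℝ} (hα : 0 < α)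
    (hω : ω = -(α ^ 2)⁻¹) {u : ℝ → ℝ → ℂ} (hu : IsPeriodicSolution q ω u) {n : ℕ} {κ : ℝ}
    {a : Fin (n + 1) → ℂ} (ha : IsCentralConfiguration n κ a) :
    IsFilamentSolution n κ (homographic a q α ω u) := by
  have hqR : (q : ℝ) ≠ 0 := by exact_mod_cast hq
  have hqC : (q : ℂ) ≠ 0 := by exact_mod_cast hq
  have hαC : (α : ℂ) ≠ 0 := by exact_mod_cast hα.ne'
  set w : ℝ → ℝ → ℂ := fun t s =>
    (α : ℂ) * Complex.exp (Complex.I * (ω : ℂ) * (t : ℂ)) * (1 + u (t / (q : ℝ)) s) with hw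
  have hU : ∀ j t s, homographic a q α ω u j t s = w t s * a j := fun j t s => by
    simp only [homographic, hw]; ring
  have hV : ∀ t s, 1 + u t s ≠ 0 := fun t s => one_add_ne_zero_of_norm_lt_one (hu.norm_lt_one t s)
  have hw0 : ∀ t s, w t s ≠ 0 := fun t s =>
    mul_ne_zero (mul_ne_zero hαC (Complex.exp_ne_zero _)) (hV _ _)
  refine ⟨fun j => ?_, fun i j hij t s => ?_, fun j t s => ?_⟩
  · have h1 : ContDiff ℝ 2 fun x : ℝ × ℝ => u (x.1 / (q : ℝ)) x.2 :=
      hu.contDiff.comp ((contDiff_fst.div_const (q : ℝ)).prodMk contDiff_snd)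
    have h2 : ContDiff ℝ 2 fun x : ℝ × ℝ => Complex.exp (Complex.I * (ω : ℂ) * (x.1 : ℂ)) :=
      (contDiff_const.mul (Complex.ofRealCLM.contDiff.comp contDiff_fst)).cexp
    exact (contDiff_const.mul h2).mul (contDiff_const.add (contDiff_const.mul h1))
  · rw [hU, hU]
    exact fun h => hij (ha.injective (mul_left_cancel₀ (hw0 t s) h))
  · have hsum : ∑ i ∈ Finset.univ.erase j, (circulation n κ i : ℂ) *
        ((homographic a q α ω u j t s - homographic a q α ω u i t s) /
          ((‖homographic a q α ω u j t s - homographic a q α ω u i t s‖ ^ 2 : ℝ) : ℂ))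
        = w t s / ((‖w t s‖ ^ 2 : ℝ) : ℂ) * (-a j) := by
      rw [ha.equation j, Finset.mul_sum]
      refine Finset.sum_congr rfl fun i _ => ?_
      rw [hU, hU, ← mul_sub, norm_mul, mul_pow, Complex.ofReal_mul, mul_div_mul_comm]
      ring
    rw [hsum]
    have hut : HasDerivAt (fun t' => u t' s) (deriv (fun t' => u t' s) (t / q)) (t / q) := by
      have h1 : ContDiff ℝ 2 fun t' : ℝ => u t' s :=
        hu.contDiff.comp (contDiff_id.prodMk contDiff_const)
      exact (h1.differentiable (by norm_num) _).hasDerivAt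
    have hut' : HasDerivAt (fun t' => u (t' / (q : ℝ)) s)
        ((1 / (q : ℝ)) • deriv (fun t' => u t' s) (t / q)) t :=
      HasDerivAt.scomp (g₁ := fun t' => u t' s) (h := fun t' => t' / (q : ℝ)) t hut
        ((hasDerivAt_id t).div_const (q : ℝ))
    have hexp : HasDerivAt (fun t' : ℝ => Complex.exp (Complex.I * (ω : ℂ) * (t' : ℂ)))
        (Complex.exp (Complex.I * (ω : ℂ) * (t : ℂ)) * (Complex.I * (ω : ℂ) * 1)) t :=
      ((Complex.ofRealCLM.hasDerivAt (x := t)).const_mul _).cexp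
    have hd : deriv (fun t' => homographic a q α ω u j t' s) t
        = a j * (α * Complex.exp (Complex.I * (ω : ℂ) * (t : ℂ)) *
          (Complex.I * ω * (1 + u (t / q) s) + deriv (fun t' => u t' s) (t / q) / q)) := by
      have := ((hexp.const_mul (α : ℂ)).mul ((hut'.const_mul (a j)).const_add (a j))).deriv
      refine this.trans ?_
      rw [Complex.real_smul]
      push_cast
      ring
    have hdd : iteratedDeriv 2 (fun s' => homographic a q α ω u j t s') s
        = a j * (α * Complex.exp (Complex.I * (ω : ℂ) * (t : ℂ)) *
          iteratedDeriv 2 (fun s' => u (t / q) s') s) := by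
      have h1 : deriv (fun s' => homographic a q α ω u j t s') = fun s' =>
          α * Complex.exp (Complex.I * (ω : ℂ) * (t : ℂ))
            * (a j * deriv (fun s' => u (t / q) s') s') := by
        funext s'
        simp only [homographic]
        rw [deriv_const_mul_field, deriv_const_add, deriv_const_mul_field]
      rw [iteratedDeriv_succ, iteratedDeriv_one, h1, deriv_const_mul_field, deriv_const_mul_field,
        iteratedDeriv_succ, iteratedDeriv_one]
      ring
    rw [hd, hdd]
    -- The central filament stays at the origin, so its circulation `-κ` does not affect its own
    -- equation; all others have circulation one.
    rcases eq_or_ne j 0 with rfl | hj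
    · simp [ha.center]
    have hΓ : circulation n κ j = 1 := by
      obtain ⟨i, rfl⟩ := Fin.exists_succ_eq.2 hj
      simp [circulation]
    rw [hΓ]
    have hpde := hu.equation (t / q) s
    simp only [linOp, nonlin] at hpde
    set E := Complex.exp (Complex.I * (ω : ℂ) * (t : ℂ)) with hE
    have hEn : ‖E‖ = 1 := by
      have : E = Complex.exp (((ω * t : ℝ) : ℂ) * Complex.I) := by
        rw [hE]; push_cast; ring_nf
      rw [this, Complex.norm_exp_ofReal_mul_I]
    set z := u (t / q) s with hz
    set ut := deriv (fun t' => u t' s) (t / q)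
    set uss := iteratedDeriv 2 (fun s' => u (t / q) s') s
    have hVz : 1 + z ≠ 0 := hV _ _
    have hVc : 1 + conj z ≠ 0 := by
      have := (map_ne_zero (starRingEnd ℂ)).2 hVz
      simpa using this
    have hwq : w t s / ((‖w t s‖ ^ 2 : ℝ) : ℂ) = E / (α * (1 + conj z)) := by
      have h1 : w t s = α * E * (1 + z) := rfl
      have h2 : ((‖w t s‖ ^ 2 : ℝ) : ℂ) = (α : ℂ) ^ 2 * ((1 + z) * (1 + conj z)) := by
        have h3 : (1 + z) * (1 + conj z) = ((‖1 + z‖ ^ 2 : ℝ) : ℂ) := by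
          have := Complex.mul_conj' (1 + z)
          rw [map_add, map_one] at this
          rw [this]
          push_cast
          rfl
        rw [h3, h1, norm_mul, norm_mul, hEn, Complex.norm_real, Real.norm_of_nonneg hα.le]
        push_cast
        ring
      rw [h2, h1]
      field_simp
    rw [hwq]
    have hωC : (ω : ℂ) * (α : ℂ) ^ 2 = -1 := by
      have : ω * α ^ 2 = -1 := by rw [hω]; field_simp
      exact_mod_cast this
    have hinv : E / (α * (1 + conj z)) = -(ω * α * E) / (1 + conj z) := by
      field_simp
      linear_combination E * hωC
    have key : Complex.I * ω * (1 + z) + ut / q = Complex.I * (uss + ω / (1 + conj z)) := by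
      have hsplit : (ω : ℂ) / (1 + conj z) = ω * (1 - conj z) + ω * conj z ^ 2 / (1 + conj z) := by
        field_simp
        ring
      rw [hsplit]
      linear_combination Complex.I * hpde + (ut / q) * Complex.I_mul_I
    rw [hinv, key]
    push_cast
    ring

/-! ### Time dependence and distinctness of the solutions -/

theorem synth_injective (r : ℕ) {f g : Coeffs}
    (h : (fun t s => synth r t s f) = fun t s => synth r t s g) : f = g := by
  ext p
  have h1 := torusCoeff_synth r f p.1 p.2
  rw [h, torusCoeff_synth] at h1
  have h2 : g p / weight r p = f p / weight r p := by exact_mod_cast h1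
  exact ((div_left_inj' (weight_pos r p).ne').1 h2).symm

theorem torusCoeff_eq_zero_of_stationary {u : ℝ → ℝ → ℂ} (hu : ∀ t s, u t s = u 0 s) {j : ℤ}
    (hj : j ≠ 0) (k : ℤ) : torusCoeff u j k = 0 := by
  have h : ∀ t s : ℝ, u t s * Complex.exp (-Complex.I * ((j : ℂ) * (t : ℂ) + (k : ℂ) * (s : ℂ)))
      = Complex.exp (Complex.I * (((-j : ℤ) : ℂ) * (t : ℂ)))
        * (u 0 s * Complex.exp (-Complex.I * ((k : ℂ) * (s : ℂ)))) := fun t s => by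
    rw [hu t s, mul_left_comm, ← Complex.exp_add]
    push_cast
    ring_nf
  simp only [torusCoeff, h, intervalIntegral.integral_const_mul,
    intervalIntegral.integral_mul_const, integral_cexp_int]
  simp [hj]

/-- The functional only reads the temporal frequencies `±j₀`, which are absent from a stationary
function. -/
theorem exists_ne_of_kernelFunctional_ne_zero {q : ℤ} {k₀ : ℕ} (hj : j0 q k₀ ≠ 0) (r : ℕ)
    {f : Coeffs} (hf : kernelFunctional q k₀ f ≠ 0) :
    ∃ t s : ℝ, synth r t s f ≠ synth r 0 s f := by
  by_contra! h
  have hz : ∀ j k : ℤ, j ≠ 0 → f (j, k) = 0 := fun j k hj => by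
    have h1 := torusCoeff_synth r f j k
    rw [torusCoeff_eq_zero_of_stationary h hj] at h1
    have h2 : f (j, k) / weight r (j, k) = 0 := by exact_mod_cast h1.symm
    exact (div_eq_zero_iff.1 h2).resolve_right (weight_pos r _).ne'
  apply hf
  rw [kernelFunctional_apply, hz _ _ hj, hz _ _ (neg_ne_zero.2 hj)]
  simp

/-- A homographic motion determines the perturbation, if the frequencies are known up to less than
`1 / q`. -/
theorem homographic_injective {n : ℕ} {κ : ℝ} {a : Fin (n + 1) → ℂ} (hn : 0 < n)
    (ha : IsCentralConfiguration n κ a) {q : ℤ} (hq : 0 < q) {α α' ω ω' : ℝ} (hα : 0 < α)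
    (hα' : 0 < α') (hω : ω = -(α ^ 2)⁻¹) (hω' : ω' = -(α' ^ 2)⁻¹) (hd : |ω - ω'| * q < 1)
    {u u' : ℝ → ℝ → ℂ} (hu : IsPeriodicSolution q ω u) (hu' : IsPeriodicSolution q ω' u')
    (h : homographic a q α ω u = homographic a q α' ω' u') : u = u' := by
  have hqR : (q : ℝ) ≠ 0 := by exact_mod_cast hq.ne'
  have haj : a (Fin.last n) ≠ 0 := ha.ne_zero fun h => hn.ne' (by simpa using congrArg Fin.val h)
  have hw : ∀ t s : ℝ,
      (α : ℂ) * Complex.exp (Complex.I * ω * t) * (1 + u (t / q) s)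
        = (α' : ℂ) * Complex.exp (Complex.I * ω' * t) * (1 + u' (t / q) s) := fun t s => by
    have := congrFun (congrFun (congrFun h (Fin.last n)) t) s
    simp only [homographic] at this
    refine mul_right_cancel₀ haj ?_
    linear_combination this
  have h0 := hw 0 0
  -- After time `2πq` both perturbations have returned to their initial values, so the two phase
  -- factors agree there and `(ω - ω') q` is an integer.
  have h1 := hw (0 + 2 * Real.pi * q) 0
  have hper : ∀ v : ℝ → ℝ → ℂ, DoublyPeriodic v →
      v ((0 + 2 * Real.pi * q) / q) 0 = v (0 / q) 0 := fun v hv => by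
    have e : ((0 : ℝ) + 2 * Real.pi * q) / q = 0 / q + 2 * Real.pi := by field_simp
    rw [e]
    exact (hv _ _).1
  rw [hper u hu.periodic, hper u' hu'.periodic] at h1
  simp only [Complex.ofReal_zero, mul_zero, Complex.exp_zero, mul_one] at h0
  have hαC : (α : ℂ) ≠ 0 := by exact_mod_cast hα.ne'
  have hne : (α : ℂ) * (1 + u (0 / q) 0) ≠ 0 :=
    mul_ne_zero hαC (one_add_ne_zero_of_norm_lt_one (hu.norm_lt_one _ _))
  have hexp : Complex.exp (Complex.I * ω * ((0 + 2 * Real.pi * q : ℝ) : ℂ))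
      = Complex.exp (Complex.I * ω' * ((0 + 2 * Real.pi * q : ℝ) : ℂ)) := by
    refine mul_right_cancel₀ hne ?_
    calc _ = (α : ℂ) * Complex.exp (Complex.I * ω * ((0 + 2 * Real.pi * q : ℝ) : ℂ))
          * (1 + u (0 / q) 0) := by ring
      _ = _ := by rw [h1, h0]; ring
  obtain ⟨m, hm⟩ := Complex.exp_eq_exp_iff_exists_int.1 hexp
  have hm' : (ω - ω') * q = m := by
    have hπ : (2 * (Real.pi : ℂ) * Complex.I) ≠ 0 := by simp [Real.pi_ne_zero]
    have : ((ω : ℂ) - ω') * q = m := by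
      refine mul_right_cancel₀ hπ ?_
      push_cast at hm
      linear_combination hm
    exact_mod_cast this
  have hm0 : m = 0 := by
    have hqpos : (0 : ℝ) < q := by exact_mod_cast hq
    have : |(m : ℝ)| < 1 := by
      rw [← hm', abs_mul, abs_of_pos hqpos]
      exact hd
    have : |m| < 1 := by exact_mod_cast this
    exact Int.abs_lt_one_iff.1 this
  have hωω : ω = ω' := by
    rw [hm0, Int.cast_zero, mul_eq_zero] at hm'
    exact sub_eq_zero.1 (hm'.resolve_right hqR)
  have hαα : α = α' := by
    rw [hω, hω', neg_inj, inv_inj] at hωω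
    exact (pow_left_inj₀ hα.le hα'.le two_ne_zero).1 hωω
  funext t s
  have h2 := hw (t * q) s
  rw [← hωω, ← hαα, mul_div_cancel_right₀ _ hqR] at h2
  exact add_left_cancel (mul_left_cancel₀ (mul_ne_zero hαC (Complex.exp_ne_zero _)) h2)

theorem isPeriodicSolution_synth {q : ℤ} {ω : ℝ} {r : ℕ} (hr : 2 ≤ r) {f : Coeffs}
    (hf : ‖f‖ < 1) (h : ∀ t s, linOp q ω (fun t s => synth r t s f) t s
      + nonlin ω (synth r t s f) = 0) : IsPeriodicSolution q ω fun t s => synth r t s f where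
  contDiff := by exact_mod_cast contDiff_synth 2 hr f
  periodic := doublyPeriodic_synth r f
  norm_lt_one t s := (norm_synth_le r t s f).trans_lt hf
  equation := h

/-- The family of homographic standing waves is infinite for every central configuration. -/
theorem infinite_homographic_standing_waves {q : ℤ} (hq : 0 < q) {n : ℕ} {κ : ℝ} (hn : 0 < n)
    {a : Fin (n + 1) → ℂ} (ha : IsCentralConfiguration n κ a) :
    Set.Infinite {U : Fin (n + 1) → ℝ → ℝ → ℂ |
      IsFilamentSolution n κ U ∧
      ∃ (α ω : ℝ) (u : ℝ → ℝ → ℂ), 0 < α ∧ ω = -(α ^ 2)⁻¹ ∧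
        IsPeriodicSolution q ω u ∧ StandingSymmetric u ∧
        (∃ t s : ℝ, u t s ≠ u 0 s) ∧ U = homographic a q α ω u} := by
  have hqR : (0 : ℝ) < q := by exact_mod_cast hq
  -- The choice `k₀ = 2` gives `j₀ = 4q - 1 ≠ 0`, whereas `k₀ = 1` has `j₀ = 0` when `q = 1`.
  have hj : j0 q 2 ≠ 0 := by unfold j0; push_cast; omega
  obtain ⟨b₀, hb₀, C, hC, f, ω, -, -, -, -, hsol⟩ :=
    exists_coeff_curve hq.ne' (k₀ := 2) two_pos (r := 2) le_rfl
  -- Keeps each `ω b` within `1 / (4q)` of `ω₀`, so any two of them differ by less than `1 / q`, as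
  -- `homographic_injective` requires.
  set b₁ := min b₀ (min 1 (1 / (4 * (C + 1) * q))) with hb₁
  have hb₁pos : 0 < b₁ := by positivity
  have hmem : ∀ b ∈ Set.Ioc 0 b₁, b ∈ Set.Icc 0 b₀ := fun b hb =>
    ⟨hb.1.le, hb.2.trans (min_le_left _ _)⟩
  have hωneg : ∀ b ∈ Set.Ioc 0 b₁, ω b < 0 := fun b hb => by
    have h1 := (hsol b (hmem b hb)).2.2.2.2.2.2
    have h2 := omega0_neg hq (k₀ := 2) two_pos
    rw [abs_of_neg h2, abs_lt] at h1
    linarith [h1.2]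
  have hωq : ∀ b ∈ Set.Ioc 0 b₁, |ω b - omega0 q 2| * q ≤ 1 / 4 := fun b hb => by
    have h1 := (hsol b (hmem b hb)).2.2.2.2.2.1
    have h2 : b ≤ 1 := hb.2.trans ((min_le_right _ _).trans (min_le_left _ _))
    have h3 : b ≤ 1 / (4 * (C + 1) * q) :=
      hb.2.trans ((min_le_right _ _).trans (min_le_right _ _))
    have h4 : b ^ 2 ≤ 1 / (4 * (C + 1) * q) := by nlinarith [hb.1]
    calc |ω b - omega0 q 2| * q ≤ (C + 1) * (1 / (4 * (C + 1) * q)) * q := by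
          gcongr
          refine h1.trans ?_
          gcongr
          linarith
      _ = 1 / 4 := by field_simp
  set α : ℝ → ℝ := fun b => (Real.sqrt (-ω b))⁻¹ with hα
  have hαpos : ∀ b ∈ Set.Ioc 0 b₁, 0 < α b := fun b hb =>
    inv_pos.2 (Real.sqrt_pos.2 (neg_pos.2 (hωneg b hb)))
  have hωα : ∀ b ∈ Set.Ioc 0 b₁, ω b = -(α b ^ 2)⁻¹ := fun b hb => by
    simp only [hα]
    rw [inv_pow, inv_inv, Real.sq_sqrt (neg_pos.2 (hωneg b hb)).le, neg_neg]
  have hper : ∀ b ∈ Set.Ioc 0 b₁, IsPeriodicSolution q (ω b) fun t s => synth 2 t s (f b) :=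
    fun b hb => isPeriodicSolution_synth le_rfl (hsol b (hmem b hb)).2.2.1
      (hsol b (hmem b hb)).2.2.2.1
  have hc := kernelFunctional_profileCoeffs_ne_zero hq.ne' (k₀ := 2) two_pos 2
  refine Set.infinite_of_injOn_mapsTo (s := Set.Ioc 0 b₁)
    (f := fun b => homographic a q (α b) (ω b) fun t s => synth 2 t s (f b)) ?_ ?_
    (Set.Ioc_infinite hb₁pos)
  · intro b hb b' hb' h
    have hd : |ω b - ω b'| * q < 1 := by
      have h1 := hωq b hb
      have h2 := hωq b' hb'
      have h3 : |ω b - ω b'| ≤ |ω b - omega0 q 2| + |ω b' - omega0 q 2| := by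
        rw [abs_sub_comm (ω b') _]
        exact abs_sub_le _ _ _
      nlinarith
    have hf := synth_injective 2 (homographic_injective hn ha hq (hαpos b hb) (hαpos b' hb')
      (hωα b hb) (hωα b' hb') hd (hper b hb) (hper b' hb') h)
    have h1 := (hsol b (hmem b hb)).2.1
    rw [hf, (hsol b' (hmem b' hb')).2.1] at h1
    exact (mul_right_cancel₀ hc h1).symm
  · intro b hb
    refine ⟨isFilamentSolution_homographic hq.ne' (hαpos b hb) (hωα b hb) (hper b hb) ha,
      α b, ω b, _, hαpos b hb, hωα b hb, hper b hb,
      standingSymmetric_synth 2 (hsol b (hmem b hb)).1, ?_, rfl⟩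
    refine exists_ne_of_kernelFunctional_ne_zero hj 2 ?_
    rw [(hsol b (hmem b hb)).2.1]
    exact mul_ne_zero hb.1.ne' hc

end VortexFilaments

end

/-! ### The main theorem -/

theorem theorem1 (q : ℤ) (hq : q ≠ 0) :
    (∀ k₀ : ℕ, 0 < k₀ → ∀ σ : ℝ, 1 < σ →
      ∃ b₀ : ℝ, 0 < b₀ ∧ ∃ C : ℝ, ∃ u : ℝ → ℝ → ℝ → ℂ, ∃ ω : ℝ → ℝ,
        -- the curve starts at the trivial solution
        u 0 = 0 ∧ ω 0 = VortexFilaments.omega0 q k₀ ∧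
        -- it is continuous into `H^σ × ℝ` and injective
        ContinuousOn ω (Set.Icc 0 b₀) ∧
        (∀ b ∈ Set.Icc 0 b₀, Filter.Tendsto
          (fun b' => VortexFilaments.sobolevNorm σ (fun t s => u b' t s - u b t s))
          (𝓝[Set.Icc 0 b₀] b) (𝓝 0)) ∧
        Set.InjOn u (Set.Icc 0 b₀) ∧
        ∀ b ∈ Set.Icc 0 b₀,
          VortexFilaments.IsPeriodicSolution q (ω b) (u b) ∧
          VortexFilaments.StandingSymmetric (u b) ∧
          VortexFilaments.sobolevNorm σ
              (fun t s => u b t s - (b : ℂ) * VortexFilaments.profile q k₀ t s)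
            ≤ ENNReal.ofReal (C * b ^ 2) ∧
          |ω b - VortexFilaments.omega0 q k₀| ≤ C * b ^ 2 ∧
          -- the associated homographic motions of the filaments
          (0 < q → ω b < 0 ∧
            ∀ α : ℝ, 0 < α → ω b = -(α ^ 2)⁻¹ →
              ∀ (n : ℕ) (κ : ℝ), 0 < κ → ∀ a : Fin (n + 1) → ℂ,
                VortexFilaments.IsCentralConfiguration n κ a →
                VortexFilaments.IsFilamentSolution n κ
                  (VortexFilaments.homographic a q α (ω b) (u b)))) ∧
    -- infinitely many time-dependent homographic standing waves for the given `q`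
    (0 < q → ∀ (n : ℕ) (κ : ℝ), 0 < n → 0 < κ → ∀ a : Fin (n + 1) → ℂ,
      VortexFilaments.IsCentralConfiguration n κ a →
      Set.Infinite {U : Fin (n + 1) → ℝ → ℝ → ℂ |
        VortexFilaments.IsFilamentSolution n κ U ∧
        ∃ (α ω : ℝ) (u : ℝ → ℝ → ℂ), 0 < α ∧ ω = -(α ^ 2)⁻¹ ∧
          VortexFilaments.IsPeriodicSolution q ω u ∧
          VortexFilaments.StandingSymmetric u ∧
          (∃ t s : ℝ, u t s ≠ u 0 s) ∧
          U = VortexFilaments.homographic a q α ω u}) := by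
  refine ⟨fun k₀ hk₀ σ hσ => ?_, fun hq0 n κ hn _ a ha =>
    VortexFilaments.infinite_homographic_standing_waves hq0 hn ha⟩
  set r : ℕ := max 2 ⌈σ⌉₊ with hr
  have hr2 : 2 ≤ r := le_max_left _ _
  have hrσ : σ ≤ r := (Nat.le_ceil σ).trans (by exact_mod_cast le_max_right _ _)
  have hσ0 : 0 ≤ σ := by linarith
  obtain ⟨b₀, hb₀, C, -, f, ω, hf0, hω0, hωc, hfc, hsol⟩ :=
    VortexFilaments.exists_coeff_curve hq hk₀ hr2
  refine ⟨b₀, hb₀, C, fun b t s => VortexFilaments.synth r t s (f b), ω, ?_, hω0, hωc, ?_, ?_, ?_⟩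
  · funext t s
    simp [hf0]
  · intro b hb
    have h1 : Filter.Tendsto (fun b' => ENNReal.ofReal ‖f b' - f b‖) (𝓝[Set.Icc 0 b₀] b) (𝓝 0) := by
      have h2 : Filter.Tendsto (fun b' => ‖f b' - f b‖) (𝓝[Set.Icc 0 b₀] b) (𝓝 0) :=
        tendsto_iff_norm_sub_tendsto_zero.1 (hfc b hb)
      simpa using ENNReal.tendsto_ofReal h2
    refine tendsto_of_tendsto_of_tendsto_of_le_of_le tendsto_const_nhds h1
      (fun _ => zero_le) fun b' => ?_
    simp only [← map_sub]
    exact VortexFilaments.sobolevNorm_synth_le hσ0 hrσ _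
  · intro b hb b' hb' h
    -- Equal functions have equal coefficients, and `kernelFunctional` of these is `b` times a
    -- nonzero constant.
    have hf := VortexFilaments.synth_injective r h
    have h1 := (hsol b hb).2.1
    rw [hf, (hsol b' hb').2.1] at h1
    exact (mul_right_cancel₀
      (VortexFilaments.kernelFunctional_profileCoeffs_ne_zero hq hk₀ r) h1).symm
  · intro b hb
    obtain ⟨heven, -, hnorm, heq, hφ, hωb, hωlt⟩ := hsol b hb
    have hper := VortexFilaments.isPeriodicSolution_synth hr2 hnorm heq
    refine ⟨hper, VortexFilaments.standingSymmetric_synth r heven, ?_, hωb, fun hq0 => ⟨?_, ?_⟩⟩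
    · have e : (fun t s => VortexFilaments.synth r t s (f b)
          - (b : ℂ) * VortexFilaments.profile q k₀ t s)
          = fun t s => VortexFilaments.synth r t s
            (f b - b • VortexFilaments.profileCoeffs r q k₀) := by
        funext t s
        rw [map_sub, map_smul, VortexFilaments.synth_profileCoeffs hq hk₀, Complex.real_smul]
      rw [e]
      exact (VortexFilaments.sobolevNorm_synth_le hσ0 hrσ _).trans (ENNReal.ofReal_le_ofReal hφ)
    · have h2 := VortexFilaments.omega0_neg hq0 hk₀
      rw [abs_of_neg h2, abs_lt] at hωlt
      linarith [hωlt.2]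
    · intro α hα hωα n κ _ a ha
      exact VortexFilaments.isFilamentSolution_homographic hq hα hωα hper ha
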